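/- Notation. For a complex Banach space $X$ with open unit ball $B_X$, let $\mathcal A_u(B_X)$ be the algebra of all holomorphic (complex-analytic), uniformly continuous functions $f\colon B_X\to\mathbb C$, with the supremum norm, and let $\mathcal M(\mathcal A_u(B_X))$ be its spectrum, the set of nonzero (continuous) multiplicative linear functionals. For $\varphi,\psi$ in the spectrum let $\|\varphi-\psi\|$ be the norm in $\mathcal A_u(B_X)^*$ (the Gleason metric), let $$\rho(\varphi,\psi)=\sup\{|\varphi(f)| : f\in\mathcal A_u(B_X),\ \|f\|\le 1,\ \psi(f)=0\}$$ be the pseudo-hyperbolic distance, and let $\mathcal{GP}(\varphi)=\{\psi\in\mathcal M(\mathcal A_u(B_X)) : \rho(\varphi,\psi)<1\}$ be the Gleason part of $\varphi$. For $\lambda$ in the closed unit disc $\overline{\mathbb D}$, $\delta_\lambda$ is evaluation at $\lambda$ of the continuous extension to $\overline{\mathbb D}$ of functions in the disc algebra $\mathcal A(\mathbb D)=\mathcal A_u(B_{\mathbb C})$. For $z$ in the closed unit ball $\overline B_{\ell_\infty}$ of $\ell_\infty=c_0^{**}$, $\delta_z(f)=\tilde f(z)$ for $f\in\mathcal A_u(B_{c_0})$,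 where $\tilde f$ is the canonical extension of $f$ to the bidual: on the open ball $B_{\ell_\infty}$ it is the sum of the Aron–Berner extensions of the homogeneous polynomials in the Taylor series of $f$ at $0$, and it is extended by continuity to $\overline B_{\ell_\infty}$. For $\lambda\in\mathbb D$ and $0<r<1$ let $$\mathcal D_r(\lambda)=\Big\{\mu\in\mathbb D : \Big|\frac{\lambda-\mu}{1-\overline\lambda\mu}\Big|<r\Big\}.$$ Theorem. The functionals $\delta_z$ ($z\in\overline B_{\ell_\infty}$) are well-defined elements of $\mathcal M(\mathcal A_u(B_{c_0}))$, the functionals $\delta_\lambda$ ($\lambda\in\overline{\mathbb D}$) are well-defined elements of $\mathcal M(\mathcal A(\mathbb D))$, and for all $z=(z_n)$ and $w=(w_n)$ in $\overline B_{\ell_\infty}$, $$\|\delta_z-\delta_w\|=\sup_{n\in\mathbb N}\|\delta_{z_n}-\delta_{w_n}\| .$$ Moreover, with $\mathbb N_0=\{n\in\mathbb N : z_n\ne w_n\}$, $$\rho(\delta_z,\delta_w)=\sup_{n\in\mathbb N}\rho(\delta_{z_n},\delta_{w_n})=\sup_{n\in\mathbb N_0}\Big|\frac{z_n-w_n}{1-\overline{z_n}\,w_n}\Big|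 ,$$ where the last supremum is $0$ if $\mathbb N_0=\varnothing$. Hence, for every $z=(z_n)\in\overline B_{\ell_\infty}$, $$\mathcal{GP}(\delta_z)=\bigcup_{0<r<1}\big\{\delta_w : w\in\overline B_{\ell_\infty},\ w_n=z_n\text{ if }|z_n|=1\text{ and } w_n\in\mathcal D_r(z_n)\text{ if }|z_n|<1\big\}.$$ -/

import Mathlib

open Metric Filter Topology
open scoped ZeroAtInfty BoundedContinuousFunction ENNReal lp

noncomputable section

namespace GleasonC0

section Algebra

variable {X : Type*} [NormedAddCommGroup X] [NormedSpace ℂ X]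

/-- A function on the open unit ball of `X`, extended by zero to all of `X`. -/
def ext {X : Type*} [NormedAddCommGroup X] (f : ball (0 : X) 1 → ℂ) : X → ℂ :=
  Function.extend Subtype.val f 0

theorem ext_apply {X : Type*} [NormedAddCommGroup X] (f : ball (0 : X) 1 → ℂ) (x : X) (hx : x ∈ ball (0 : X) 1) :
    ext f x = f ⟨x, hx⟩ :=
  Subtype.val_injective.extend_apply f 0 ⟨x, hx⟩

variable (X) in
/-- The algebra `𝒜ᵤ(B_X)` of holomorphic (complex-analytic), uniformly continuous functions on the
open unit ball of `X`, with the supremum norm.  (A uniformly continuous function on the ball is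
automatically bounded.) -/
def Au : Subalgebra ℂ (ball (0 : X) 1 →ᵇ ℂ) where
  carrier := {f | AnalyticOnNhd ℂ (ext f) (ball (0 : X) 1) ∧ UniformContinuous f}
  mul_mem' := by
    rintro f g ⟨hf, hf'⟩ ⟨hg, hg'⟩
    refine ⟨(hf.mul hg).congr isOpen_ball fun x hx => ?_, ?_⟩
    · simp [ext_apply, hx]
    · rw [Metric.uniformContinuous_iff] at *
      intro ε hε
      have hC : 0 < ‖f‖ + ‖g‖ + 1 := by positivity
      obtain ⟨d₁, hd₁, h₁⟩ := hf' (ε / (‖f‖ + ‖g‖ + 1)) (by positivity)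
      obtain ⟨d₂, hd₂, h₂⟩ := hg' (ε / (‖f‖ + ‖g‖ + 1)) (by positivity)
      refine ⟨min d₁ d₂, lt_min hd₁ hd₂, fun {a b} hab => ?_⟩
      have e₁ := h₁ (lt_of_lt_of_le hab (min_le_left _ _))
      have e₂ := h₂ (lt_of_lt_of_le hab (min_le_right _ _))
      rw [dist_eq_norm] at *
      have e : (f * g) a - (f * g) b = f a * (g a - g b) + (f a - f b) * g b := by
        simp only [BoundedContinuousFunction.mul_apply]; ring
      rw [e]
      calc _ ≤ ‖f a‖ * ‖g a - g b‖ + ‖f a - f b‖ * ‖g b‖ := by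
            refine (norm_add_le _ _).trans ?_
            rw [norm_mul, norm_mul]
        _ ≤ ‖f‖ * (ε / (‖f‖ + ‖g‖ + 1)) + (ε / (‖f‖ + ‖g‖ + 1)) * ‖g‖ := by
            gcongr
            · exact f.norm_coe_le_norm a
            · exact g.norm_coe_le_norm b
        _ < (‖f‖ + ‖g‖ + 1) * (ε / (‖f‖ + ‖g‖ + 1)) := by
            have : 0 < ε / (‖f‖ + ‖g‖ + 1) := by positivity
            nlinarith
        _ = ε := by field_simp
  add_mem' := by
    rintro f g ⟨hf, hf'⟩ ⟨hg, hg'⟩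
    refine ⟨(hf.add hg).congr isOpen_ball fun x hx => ?_, hf'.add hg'⟩
    simp [ext_apply, hx]
  algebraMap_mem' := by
    intro c
    refine ⟨(analyticOnNhd_const (v := c)).congr isOpen_ball fun x hx => ?_, ?_⟩
    · rw [ext_apply _ x hx]; rfl
    · exact uniformContinuous_const (b := c)

/-- The value at a point `x` of the closed unit ball of the continuous extension of `f` to that
closed ball. -/
def evalClosed (f : Au X) (x : X) : ℂ :=
  extendFrom (ball (0 : X) 1) (ext (f : ball (0 : X) 1 →ᵇ ℂ)) x

variable (X) in
/-- The bidual of `X`. -/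
abbrev Bidual : Type _ := StrongDual ℂ (StrongDual ℂ X)

/-- The Aron–Berner extension of continuous multilinear forms `A` on `X` to the bidual of `X`:
`aronBerner m ζ A` is the value at `(ζ₀, …, ζₘ₋₁)` of the extension of `A`, obtained by extending
one variable after the other, see `aronBerner_succ_apply`. -/
def aronBerner : (m : ℕ) → (Fin m → Bidual X) → StrongDual ℂ (X [×m]→L[ℂ] ℂ)
  | 0, _ => ContinuousMultilinearMap.apply ℂ (fun _ : Fin 0 => X) ℂ 0
  | m + 1, ζ =>
      ((ζ 0).comp (ContinuousLinearMap.compL ℂ X (X [×m]→L[ℂ] ℂ) ℂ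
        (aronBerner m (Fin.tail ζ)))).comp
        (continuousMultilinearCurryLeftEquiv ℂ (fun _ : Fin (m + 1) => X)
          ℂ).toContinuousLinearEquiv.toContinuousLinearMap

theorem aronBerner_succ_apply (m : ℕ) (ζ : Fin (m + 1) → Bidual X) (A : X [×(m + 1)]→L[ℂ] ℂ) :
    aronBerner (m + 1) ζ A = ζ 0 ((aronBerner m (Fin.tail ζ)).comp A.curryLeft) := rfl

/-- The canonical extension of `f` to the open unit ball of the bidual: the sum of the Aron–Berner
extensions of the homogeneous polynomials in the Taylor series of `f` at the origin. -/
def canonicalExt (f : Au X) (ζ : Bidual X) : ℂ :=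
  ∑' m : ℕ, aronBerner m (fun _ => ζ)
    ((Nat.factorial m : ℂ)⁻¹ • iteratedFDeriv ℂ m (ext (f : ball (0 : X) 1 →ᵇ ℂ)) 0)

/-- The value at a point `ζ` of the closed unit ball of the bidual of the canonical extension of
`f`, extended by continuity from the open ball to the closed ball. -/
def canonicalExtClosed (f : Au X) (ζ : Bidual X) : ℂ :=
  extendFrom (ball (0 : Bidual X) 1) (canonicalExt f) ζ

variable (X) in
/-- The spectrum `ℳ(𝒜ᵤ(B_X))`. -/
abbrev Spec : Type _ := WeakDual.characterSpace ℂ (Au X)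

/-- The Gleason metric `‖φ - ψ‖`, the norm being that of the dual Banach space of `𝒜ᵤ(B_X)`. -/
def gleasonDist (φ ψ : Spec X) : ℝ :=
  ‖WeakDual.toStrongDual (φ : WeakDual ℂ (Au X)) - WeakDual.toStrongDual (ψ : WeakDual ℂ (Au X))‖

/-- The pseudo-hyperbolic distance on the spectrum. -/
def rho (φ ψ : Spec X) : ℝ :=
  sSup {t : ℝ | ∃ f : Au X, ‖f‖ ≤ 1 ∧ ψ f = 0 ∧ t = ‖φ f‖}

/-- The Gleason part of `φ`. -/
def gleasonPart (φ : Spec X) : Set (Spec X) :=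
  {ψ | rho φ ψ < 1}

end Algebra

/-- The pseudo-hyperbolic disc `𝒟ᵣ(a)` in the open unit disc. -/
def pseudoDisc (r : ℝ) (a : ℂ) : Set ℂ :=
  {b | ‖b‖ < 1 ∧ ‖(a - b) / (1 - starRingEnd ℂ a * b)‖ < r}

/-- The unit vector `eₙ` of `c₀ = C₀(ℕ, ℂ)`. -/
def unitVec (n : ℕ) : C₀(ℕ, ℂ) where
  toFun := Pi.single n 1
  continuous_toFun := continuous_of_discreteTopology
  zero_at_infty' := by
    rw [Filter.cocompact_eq_cofinite]
    refine tendsto_const_nhds.congr' ?_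
    filter_upwards [(Set.finite_singleton n).compl_mem_cofinite] with k hk
    have : k ≠ n := by simpa using hk
    simp [Pi.single_eq_of_ne this]

theorem unitVec_apply (n k : ℕ) : unitVec n k = if k = n then 1 else 0 := by
  change Pi.single (M := fun _ : ℕ => ℂ) n 1 k = _
  rw [Pi.single_apply]

theorem sum_norm_unitVec_le (y : StrongDual ℂ C₀(ℕ, ℂ)) (s : Finset ℕ) :
    ∑ n ∈ s, ‖y (unitVec n)‖ ≤ ‖y‖ := by
  have hu : ∀ n : ℕ, ∃ u : ℂ, ‖u‖ ≤ 1 ∧ u * y (unitVec n) = (‖y (unitVec n)‖ : ℂ) := by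
    intro n
    by_cases h : y (unitVec n) = 0
    · exact ⟨0, by simp, by simp [h]⟩
    · have h' : (‖y (unitVec n)‖ : ℂ) ≠ 0 := by simpa using h
      refine ⟨‖y (unitVec n)‖ / y (unitVec n), ?_, by field_simp⟩
      rw [norm_div, Complex.norm_real, norm_norm, div_self (norm_ne_zero_iff.2 h)]
  choose u hu₁ hu₂ using hu
  have e : y (∑ n ∈ s, u n • unitVec n) = ((∑ n ∈ s, ‖y (unitVec n)‖ : ℝ) : ℂ) := by
    simp [map_sum, hu₂]
  have hv : ‖∑ n ∈ s, u n • unitVec n‖ ≤ 1 := by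
    rw [← ZeroAtInftyContinuousMap.norm_toBCF_eq_norm,
      BoundedContinuousFunction.norm_le zero_le_one]
    intro k
    have e' : (∑ n ∈ s, u n • unitVec n) k = ∑ n ∈ s, u n * unitVec n k := by
      classical
      induction s using Finset.induction_on with
      | empty => simp
      | insert a t ha ih => simp_all [Finset.sum_insert ha]
    change ‖(∑ n ∈ s, u n • unitVec n) k‖ ≤ 1
    rw [e']
    simp only [unitVec_apply, mul_ite, mul_one, mul_zero, Finset.sum_ite_eq]
    split_ifs
    · exact hu₁ k
    · simp
  have h₀ : 0 ≤ ∑ n ∈ s, ‖y (unitVec n)‖ := Finset.sum_nonneg fun _ _ => norm_nonneg _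
  calc ∑ n ∈ s, ‖y (unitVec n)‖ = ‖y (∑ n ∈ s, u n • unitVec n)‖ := by
        rw [e, Complex.norm_real, Real.norm_of_nonneg h₀]
    _ ≤ ‖y‖ * ‖∑ n ∈ s, u n • unitVec n‖ := y.le_opNorm _
    _ ≤ ‖y‖ := mul_le_of_le_one_right y.opNorm_nonneg hv

theorem summable_pairing (z : ℓ^∞(ℕ, ℂ)) (y : StrongDual ℂ C₀(ℕ, ℂ)) :
    Summable fun n => ‖z n * y (unitVec n)‖ := by
  have h : Summable fun n => ‖y (unitVec n)‖ :=
    summable_of_sum_le (fun _ => norm_nonneg _) (sum_norm_unitVec_le y)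
  refine (h.mul_left ‖z‖).of_nonneg_of_le (fun _ => norm_nonneg _) fun n => ?_
  rw [norm_mul]
  gcongr
  exact lp.norm_apply_le_norm ENNReal.top_ne_zero z n

/-- The identification of `ℓ_∞` with the bidual of `c₀`: the sequence `z` acts on
`y ∈ c₀* = ℓ₁` by `∑ₙ zₙ y(eₙ)`. -/
def toBidual (z : ℓ^∞(ℕ, ℂ)) : Bidual C₀(ℕ, ℂ) :=
  LinearMap.mkContinuous
    { toFun := fun y => ∑' n, z n * y (unitVec n)
      map_add' := fun y y' => by
        simp only [_root_.add_apply, mul_add]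
        exact (summable_pairing z y).of_norm.tsum_add (summable_pairing z y').of_norm
      map_smul' := fun c y => by
        simp only [_root_.smul_apply, smul_eq_mul, RingHom.id_apply, mul_left_comm]
        exact tsum_mul_left }
    ‖z‖ fun y => by
      have h : Summable fun n => ‖y (unitVec n)‖ :=
        summable_of_sum_le (fun _ => norm_nonneg _) (sum_norm_unitVec_le y)
      refine (norm_tsum_le_tsum_norm (summable_pairing z y)).trans ?_
      refine ((summable_pairing z y).tsum_le_tsum (fun n => ?_) (h.mul_left ‖z‖)).trans ?_
      · rw [norm_mul]
        gcongr
        exact lp.norm_apply_le_norm ENNReal.top_ne_zero z n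
      · rw [tsum_mul_left]
        gcongr
        exact h.tsum_le_of_sum_le (sum_norm_unitVec_le y)

/-- The coordinates of a point of the closed unit ball of `ℓ_∞`, as points of the closed disc. -/
def coord (z : closedBall (0 : ℓ^∞(ℕ, ℂ)) 1) (n : ℕ) : closedBall (0 : ℂ) 1 :=
  ⟨z.1 n, by
    rw [mem_closedBall_zero_iff]
    exact (lp.norm_apply_le_norm ENNReal.top_ne_zero z.1 n).trans
      (mem_closedBall_zero_iff.1 z.2)⟩

end GleasonC0

end

/-!
Every bounded multilinear form on `c₀` is the norm limit of its restrictions to finitely many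
coordinates: an operator from `c₀` to a space without a copy of `c₀` is the norm limit of its
truncations, and the spaces of multilinear forms on `c₀` contain no copy of `c₀`. Hence the
canonical extension of `f` at `z` is a limit of values of `f` at truncations of `z`, and a point of
the spectrum is determined by its values at the coordinate functions, so it is some `δ_z`.

If the pseudo-hyperbolic distances of `zₙ` and `wₙ` are all at most `s < 1`, then there are analytic
self-maps of the disc with values `zₙ` at `s` and `wₙ` at `0`. They form an analytic disc in the
ball, and the Schwarz lemma on it gives `ρ(δ_z, δ_w) ≤ s`. Conversely, composing a coordinate
function with a Möbius transformation bounds `ρ(δ_z, δ_w)` below by each of those distances.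

The Gleason metric is a function of the pseudo-hyperbolic one: for any two points of the spectrum,
`‖φ - ψ‖` is the supremum of `|a - b|` over the points `a`, `b` of the disc at pseudo-hyperbolic
distance less than `ρ(φ, ψ)`. This turns the formula for `ρ(δ_z, δ_w)` into that for `‖δ_z - δ_w‖`.
-/

noncomputable section

namespace GleasonC0

section CZero

theorem norm_le_of_forall_apply_le {x : C₀(ℕ, ℂ)} {C : ℝ} (hC : 0 ≤ C) (h : ∀ n, ‖x n‖ ≤ C) :
    ‖x‖ ≤ C := by
  rw [← ZeroAtInftyContinuousMap.norm_toBCF_eq_norm, BoundedContinuousFunction.norm_le hC]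
  exact h

theorem norm_apply_le (x : C₀(ℕ, ℂ)) (n : ℕ) : ‖x n‖ ≤ ‖x‖ := by
  rw [← ZeroAtInftyContinuousMap.norm_toBCF_eq_norm]
  exact x.toBCF.norm_coe_le_norm n

/-- The `n`-th coordinate functional on `c₀`. -/
def coordFun (n : ℕ) : StrongDual ℂ C₀(ℕ, ℂ) :=
  LinearMap.mkContinuous
    { toFun := fun x => x n
      map_add' := fun _ _ => rfl
      map_smul' := fun _ _ => rfl } 1 fun x => by simpa using norm_apply_le x n

@[simp]
theorem coordFun_apply (n : ℕ) (x : C₀(ℕ, ℂ)) : coordFun n x = x n := rfl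

theorem norm_coordFun_le (n : ℕ) : ‖coordFun n‖ ≤ 1 :=
  LinearMap.mkContinuous_norm_le _ zero_le_one _

theorem norm_bidual_coordFun_le (ζ : Bidual C₀(ℕ, ℂ)) (n : ℕ) : ‖ζ (coordFun n)‖ ≤ ‖ζ‖ :=
  ζ.unit_le_opNorm _ (norm_coordFun_le n)

theorem sum_apply {ι : Type*} (s : Finset ι) (v : ι → C₀(ℕ, ℂ)) (k : ℕ) :
    (∑ i ∈ s, v i) k = ∑ i ∈ s, v i k :=
  map_sum (coordFun k) v s

theorem norm_sum_smul_unitVec_le {u : ℕ → ℂ} {C : ℝ} (hC : 0 ≤ C) (hu : ∀ n, ‖u n‖ ≤ C)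
    (t : Finset ℕ) : ‖∑ n ∈ t, u n • unitVec n‖ ≤ C := by
  refine norm_le_of_forall_apply_le hC fun k => ?_
  have happly : (∑ n ∈ t, u n • unitVec n) k = if k ∈ t then u k else 0 := by
    simp [sum_apply, unitVec_apply]
  rw [happly]
  split_ifs
  · exact hu k
  · rwa [norm_zero]

/-- The truncation of an element of `c₀**` to its first `N` coordinates. -/
def trunc (N : ℕ) : Bidual C₀(ℕ, ℂ) →L[ℂ] C₀(ℕ, ℂ) :=
  ∑ i ∈ Finset.range N, (ContinuousLinearMap.apply ℂ ℂ (coordFun i)).smulRight (unitVec i)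

theorem trunc_eq_sum (N : ℕ) (ζ : Bidual C₀(ℕ, ℂ)) :
    trunc N ζ = ∑ i ∈ Finset.range N, ζ (coordFun i) • unitVec i := by
  simp [trunc]

theorem trunc_apply (N : ℕ) (ζ : Bidual C₀(ℕ, ℂ)) (k : ℕ) :
    trunc N ζ k = if k < N then ζ (coordFun k) else 0 := by
  rw [trunc_eq_sum, sum_apply]
  simp [unitVec_apply]

theorem norm_trunc_le (N : ℕ) (ζ : Bidual C₀(ℕ, ℂ)) : ‖trunc N ζ‖ ≤ ‖ζ‖ := by
  rw [trunc_eq_sum]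
  exact norm_sum_smul_unitVec_le ζ.opNorm_nonneg (norm_bidual_coordFun_le ζ) _

/-- The projection of `c₀` onto its first `N` coordinates. -/
def proj (N : ℕ) : C₀(ℕ, ℂ) →L[ℂ] C₀(ℕ, ℂ) :=
  (trunc N).comp (NormedSpace.inclusionInDoubleDual ℂ C₀(ℕ, ℂ))

theorem proj_eq_sum (N : ℕ) (x : C₀(ℕ, ℂ)) :
    proj N x = ∑ i ∈ Finset.range N, x i • unitVec i :=
  trunc_eq_sum N _

theorem proj_apply (N : ℕ) (x : C₀(ℕ, ℂ)) (k : ℕ) : proj N x k = if k < N then x k else 0 :=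
  trunc_apply N _ k

theorem norm_proj_le (N : ℕ) : ‖proj N‖ ≤ 1 :=
  ContinuousLinearMap.opNorm_le_bound _ zero_le_one fun x => by
    rw [one_mul]
    exact (norm_trunc_le N _).trans (NormedSpace.double_dual_bound ℂ _ x)

theorem tendsto_proj (x : C₀(ℕ, ℂ)) : Tendsto (fun N => proj N x) atTop (𝓝 x) := by
  have hx : Tendsto x atTop (𝓝 0) := by
    simpa [Filter.cocompact_eq_cofinite, Nat.cofinite_eq_atTop] using x.zero_at_infty'
  refine Metric.tendsto_atTop.2 fun ε hε => ?_
  obtain ⟨K, hK⟩ := Metric.tendsto_atTop.1 hx (ε / 2) (half_pos hε)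
  refine ⟨K, fun N hN => ?_⟩
  rw [dist_eq_norm]
  refine (norm_le_of_forall_apply_le (half_pos hε).le fun k => ?_).trans_lt (half_lt_self hε)
  rw [ZeroAtInftyContinuousMap.sub_apply, proj_apply]
  split_ifs with hk
  · simpa using (half_pos hε).le
  · simpa using (hK k (by omega)).le

end CZero

section NoC0

set_option maxSynthPendingDepth 3

variable {E F : Type*} [NormedAddCommGroup E] [NormedSpace ℂ E]
  [NormedAddCommGroup F] [NormedSpace ℂ F]

/-- The series `∑ₖ xₖ` is weakly unconditionally Cauchy, with constant `C`: this is the form of the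
condition that bounds the finite sums `∑ aₖ xₖ` with coefficients in the closed unit disc. -/
def IsWUC (C : ℝ) (x : ℕ → E) : Prop :=
  ∀ (s : Finset ℕ) (a : ℕ → ℂ), (∀ k, ‖a k‖ ≤ 1) → ‖∑ k ∈ s, a k • x k‖ ≤ C

variable (E) in
/-- The terms of every weakly unconditionally Cauchy series in `E` tend to zero. By the theorem of
Bessaga and Pełczyński, a Banach space has this property exactly when it contains no isomorphic
copy of `c₀`. -/
def HasNoC0 : Prop :=
  ∀ (C : ℝ) (x : ℕ → E), IsWUC C x → Tendsto x atTop (𝓝 0)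

theorem IsWUC.comp {C : ℝ} {x : ℕ → E} (hx : IsWUC C x) {k : ℕ → ℕ}
    (hk : Function.Injective k) : IsWUC C (x ∘ k) := by
  intro s a ha
  have := hx (s.map ⟨k, hk⟩) (Function.extend k a 0) fun j => by
    by_cases h : ∃ i, k i = j
    · obtain ⟨i, rfl⟩ := h
      rw [hk.extend_apply]
      exact ha i
    · rw [Function.extend_apply' _ _ _ h]
      simp
  simpa [Finset.sum_map, hk.extend_apply] using this

theorem IsWUC.map {C : ℝ} {x : ℕ → E} (hx : IsWUC C x) (T : E →L[ℂ] F) :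
    IsWUC (‖T‖ * C) fun k => T (x k) := by
  intro s a ha
  have hT : ∑ k ∈ s, a k • T (x k) = T (∑ k ∈ s, a k • x k) := by simp [map_sum]
  rw [hT]
  exact T.le_opNorm_of_le (hx s a ha)

theorem sum_range_div_pow_of_isPrimitiveRoot {ω : ℂ} {n k l : ℕ} (hω : IsPrimitiveRoot ω n)
    (hk : k < n) (hl : l < n) :
    ∑ j ∈ Finset.range n, (ω ^ k / ω ^ l) ^ j = if k = l then (n : ℂ) else 0 := by
  have hω₀ : ω ^ l ≠ 0 := pow_ne_zero _ (hω.ne_zero (by omega))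
  split_ifs with h
  · simp [h, div_self hω₀]
  · have hne : ω ^ k / ω ^ l ≠ 1 := by
      rw [Ne, div_eq_one_iff_eq hω₀]
      exact fun e => h (hω.pow_inj hk hl e)
    rw [geom_sum_eq hne, div_pow, ← pow_mul, ← pow_mul, mul_comm k, mul_comm l, pow_mul, pow_mul,
      hω.pow_eq_one]
    simp

/- With `ω` a primitive `n`-th root of unity, the diagonal sum is the average over `j < n` of
`(∑ₖ ω⁻ʲᵏ xₖ) (∑ₖ ωʲᵏ vₖ)`. -/
theorem norm_sum_diagonal_le {s : Finset ℕ} {x : ℕ → F →L[ℂ] E} {v : ℕ → F} {C : ℝ}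
    (h : ∀ a b : ℕ → ℂ, (∀ k, ‖a k‖ ≤ 1) → (∀ k, ‖b k‖ ≤ 1) →
      ‖(∑ k ∈ s, a k • x k) (∑ k ∈ s, b k • v k)‖ ≤ C) :
    ‖∑ k ∈ s, x k (v k)‖ ≤ C := by
  obtain ⟨m, hm⟩ := s.exists_nat_subset_range
  let n := m + 1
  have hlt : ∀ k ∈ s, k < n := fun k hk => (Finset.mem_range.1 (hm hk)).trans m.lt_succ_self
  let ω : ℂ := Complex.exp (2 * Real.pi * Complex.I / n)
  have hω : IsPrimitiveRoot ω n := Complex.isPrimitiveRoot_exp n m.succ_ne_zero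
  have hω₁ : ‖ω‖ = 1 := hω.norm'_eq_one m.succ_ne_zero
  have havg : ∑ j ∈ Finset.range n,
      (∑ k ∈ s, (ω ^ k)⁻¹ ^ j • x k) (∑ k ∈ s, (ω ^ k) ^ j • v k) =
        (n : ℂ) • ∑ k ∈ s, x k (v k) := by
    simp only [_root_.sum_apply, _root_.smul_apply, map_sum, map_smul, Finset.smul_sum, smul_smul,
      ← mul_pow, ← div_eq_mul_inv]
    rw [Finset.sum_comm]
    refine Finset.sum_congr rfl fun k hk => ?_
    rw [Finset.sum_comm]
    simp only [← Finset.sum_smul]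
    rw [Finset.sum_eq_single_of_mem k hk fun l hl hlk => by
        rw [sum_range_div_pow_of_isPrimitiveRoot hω (hlt k hk) (hlt l hl), if_neg hlk.symm,
          zero_smul],
      sum_range_div_pow_of_isPrimitiveRoot hω (hlt k hk) (hlt k hk), if_pos rfl]
  have hle : ‖(n : ℂ) • ∑ k ∈ s, x k (v k)‖ ≤ n * C := by
    rw [← havg]
    refine (norm_sum_le_of_le _ fun j _ => h (fun k => (ω ^ k)⁻¹ ^ j) (fun k => (ω ^ k) ^ j)
      (fun k => ?_) fun k => ?_).trans_eq ?_ <;> simp [hω₁]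
  rw [norm_smul, Complex.norm_natCast] at hle
  exact le_of_mul_le_mul_left hle (Nat.cast_pos.2 m.succ_pos)

theorem IsWUC.apply {C D : ℝ} {x : ℕ → F →L[ℂ] E} {v : ℕ → F} (hx : IsWUC C x)
    (hv : IsWUC D v) : IsWUC (C * D) fun k => x k (v k) := by
  intro s a ha
  refine norm_sum_diagonal_le (x := fun k => a k • x k) fun b c hb hc => ?_
  refine ContinuousLinearMap.le_of_opNorm_le_of_le _ ?_ (hv s c hc)
  simp only [smul_smul]
  exact hx s (fun k => b k * a k) fun k => by
    rw [norm_mul]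
    exact mul_le_one₀ (hb k) (norm_nonneg _) (ha k)

theorem HasNoC0.of_linearIsometry (h : HasNoC0 F) (e : E →ₗᵢ[ℂ] F) : HasNoC0 E := by
  intro C x hx
  have := h _ _ (hx.map e.toContinuousLinearMap)
  rw [tendsto_zero_iff_norm_tendsto_zero] at this ⊢
  simpa using this

theorem hasNoC0_complex : HasNoC0 ℂ := by
  intro C x hx
  refine tendsto_zero_iff_norm_tendsto_zero.2 (Summable.tendsto_atTop_zero ?_)
  refine summable_of_sum_le (c := C) (fun _ => norm_nonneg _) fun s => ?_
  choose u hu₁ hu₂ using fun n => Complex.exists_norm_mul_eq_self (x n)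
  have hu₃ : ∀ n, (u n)⁻¹ * x n = ‖x n‖ := fun n => by
    have : u n ≠ 0 := norm_ne_zero_iff.1 (by simp [hu₁])
    rw [← hu₂ n]
    simp [hu₁, this]
  have := hx s (fun n => (u n)⁻¹) fun n => by simp [hu₁]
  simp only [smul_eq_mul, hu₃] at this
  rw [← Complex.ofReal_sum, Complex.norm_real] at this
  exact (le_abs_self _).trans this

/-- `v` lies in the unit ball of `c₀` and is supported in `[N, M)`. -/
structure IsBlock (N M : ℕ) (v : C₀(ℕ, ℂ)) : Prop where
  norm_le : ‖v‖ ≤ 1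
  apply_eq_zero : ∀ k ∉ Finset.Ico N M, v k = 0

theorem IsBlock.mono {N M M' : ℕ} {v : C₀(ℕ, ℂ)} (h : IsBlock N M v) (hM : M ≤ M') :
    IsBlock N M' v :=
  ⟨h.norm_le, fun k hk => h.apply_eq_zero k fun hk' => hk (Finset.Ico_subset_Ico_right hM hk')⟩

theorem isBlock_proj_sub_proj {N M : ℕ} (hNM : N ≤ M) {x : C₀(ℕ, ℂ)} (hx : ‖x‖ ≤ 1) :
    IsBlock N M (proj M x - proj N x) where
  norm_le := norm_le_of_forall_apply_le zero_le_one fun k => by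
    have := (norm_apply_le x k).trans hx
    rw [ZeroAtInftyContinuousMap.sub_apply, proj_apply, proj_apply]
    split_ifs <;> simp [this]
  apply_eq_zero k hk := by
    rw [Finset.mem_Ico] at hk
    rw [ZeroAtInftyContinuousMap.sub_apply, proj_apply, proj_apply]
    split_ifs <;> first | omega | simp

theorem isWUC_of_isBlock {N : ℕ → ℕ} (hN : Monotone N) {v : ℕ → C₀(ℕ, ℂ)}
    (hv : ∀ n, IsBlock (N n) (N (n + 1)) (v n)) : IsWUC 1 v := by
  intro s a ha
  refine norm_le_of_forall_apply_le zero_le_one fun k => ?_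
  rw [sum_apply]
  by_cases h : ∃ n ∈ s, v n k ≠ 0
  · obtain ⟨n, hn, hk⟩ := h
    have hkn := Finset.mem_Ico.1 (not_imp_comm.1 ((hv n).apply_eq_zero k) hk)
    rw [Finset.sum_eq_single_of_mem n hn fun j _ hj => by
      rw [ZeroAtInftyContinuousMap.smul_apply, (hv j).apply_eq_zero k, smul_zero]
      rw [Finset.mem_Ico]
      rintro ⟨hjk, hkj⟩
      rcases lt_or_gt_of_ne hj with hj | hj
      · exact absurd ((hkj.trans_le (hN hj)).trans_le hkn.1) (lt_irrefl k)
      · exact absurd ((hkn.2.trans_le (hN hj)).trans_le hjk) (lt_irrefl k)]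
    rw [ZeroAtInftyContinuousMap.smul_apply, norm_smul]
    exact mul_le_one₀ (ha n) (norm_nonneg _) ((norm_apply_le _ _).trans (hv n).norm_le)
  · push Not at h
    rw [Finset.sum_eq_zero fun n hn => by
      rw [ZeroAtInftyContinuousMap.smul_apply, h n hn, smul_zero]]
    simp

theorem exists_seq_isBlock {P : ℕ → ℕ → C₀(ℕ, ℂ) → Prop}
    (h : ∀ N, ∃ M ≥ N, ∃ v, IsBlock N M v ∧ P N M v) :
    ∃ (N : ℕ → ℕ) (v : ℕ → C₀(ℕ, ℂ)), Monotone N ∧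
      ∀ n, IsBlock (N n) (N (n + 1)) (v n) ∧ P (N n) (N (n + 1)) (v n) := by
  choose M hM v hv using h
  refine ⟨fun n => M^[n] 0, fun n => v (M^[n] 0), monotone_nat_of_le_succ fun n => ?_, fun n => ?_⟩
  · simpa only [Function.iterate_succ_apply'] using hM _
  · simpa only [Function.iterate_succ_apply'] using hv _

theorem exists_isBlock_lt {T : C₀(ℕ, ℂ) →L[ℂ] E} {c : ℝ} {N : ℕ}
    (hc : c < ‖T - T.comp (proj N)‖) : ∃ M ≥ N, ∃ v, IsBlock N M v ∧ c < ‖T v‖ := by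
  obtain ⟨x, hx, hTx⟩ := ContinuousLinearMap.exists_lt_apply_of_lt_opNorm _ hc
  have hlim : Tendsto (fun M => ‖T (proj M x - proj N x)‖) atTop (𝓝 ‖T (x - proj N x)‖) :=
    ((T.continuous.tendsto _).comp ((tendsto_proj x).sub_const _)).norm
  have hlt : c < ‖T (x - proj N x)‖ := by simpa using hTx
  obtain ⟨M, hM, hNM⟩ := ((hlim.eventually_const_lt hlt).and (eventually_ge_atTop N)).exists
  exact ⟨M, hNM, _, isBlock_proj_sub_proj hNM hx.le, hM⟩

theorem exists_frequently_le_norm {E : Type*} [SeminormedAddCommGroup E] {x : ℕ → E}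
    (hx : ¬Tendsto x atTop (𝓝 0)) :
    ∃ ε > 0, ∃ᶠ n in atTop, ε ≤ ‖x n‖ := by
  simpa only [Metric.tendsto_nhds, dist_zero_right, not_forall, not_eventually, not_lt,
    exists_prop] using hx

theorem HasNoC0.tendsto_comp_proj (hE : HasNoC0 E) (T : C₀(ℕ, ℂ) →L[ℂ] E) :
    Tendsto (fun N => T.comp (proj N)) atTop (𝓝 T) := by
  rw [← tendsto_sub_nhds_zero_iff]
  by_contra hcon
  obtain ⟨ε, hε, hcon⟩ := exists_frequently_le_norm hcon
  have hblock : ∀ N, ∃ M ≥ N, ∃ v, IsBlock N M v ∧ ε / 2 < ‖T v‖ := fun N => by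
    obtain ⟨K, hK, hNK⟩ := (hcon.and_eventually (eventually_ge_atTop N)).exists
    rw [norm_sub_rev] at hK
    obtain ⟨M, hM, v, hv, hTv⟩ := exists_isBlock_lt ((half_lt_self hε).trans_le hK)
    exact ⟨M, hNK.trans hM, v, ⟨hv.norm_le, fun k hk => hv.apply_eq_zero k fun hk' =>
      hk (Finset.Ico_subset_Ico_left hNK hk')⟩, hTv⟩
  obtain ⟨N, v, hN, hv⟩ := exists_seq_isBlock hblock
  have hlim := hE _ _ ((isWUC_of_isBlock hN fun n => (hv n).1).map T)
  obtain ⟨n, hn⟩ := (hlim.norm.eventually_lt_const (u := ε / 2) (by simpa using half_pos hε)).exists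
  exact lt_asymm hn (hv n).2

theorem comp_proj_eq_sum (T : C₀(ℕ, ℂ) →L[ℂ] E) (N : ℕ) :
    T.comp (proj N) = ∑ i ∈ Finset.range N, (coordFun i).smulRight (T (unitVec i)) := by
  ext x
  simp [proj_eq_sum, map_sum]

theorem tendsto_comp_proj_of_pointwise {ι : Type*} {l : Filter ι} {x : ι → C₀(ℕ, ℂ) →L[ℂ] E}
    {T : C₀(ℕ, ℂ) →L[ℂ] E} (h : ∀ u, Tendsto (fun k => x k u) l (𝓝 (T u))) (N : ℕ) :
    Tendsto (fun k => (x k).comp (proj N)) l (𝓝 (T.comp (proj N))) := by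
  simp only [comp_proj_eq_sum]
  exact tendsto_finsetSum _ fun i _ =>
    ((ContinuousLinearMap.smulRightL ℂ C₀(ℕ, ℂ) E (coordFun i)).continuous.tendsto _).comp
      (h (unitVec i))

theorem HasNoC0.clm (hE : HasNoC0 E) : HasNoC0 (C₀(ℕ, ℂ) →L[ℂ] E) := by
  intro C x hx
  by_contra hcon
  obtain ⟨ε, hε, hcon⟩ := exists_frequently_le_norm hcon
  have hproj : ∀ N, Tendsto (fun k => ‖(x k).comp (proj N)‖) atTop (𝓝 0) := fun N => by
    have := tendsto_comp_proj_of_pointwise (T := 0)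
      (fun u => hE _ _ (hx.map (ContinuousLinearMap.apply ℂ E u))) N
    simpa using this.norm
  have hblock : ∀ N, ∃ M ≥ N, ∃ v, IsBlock N M v ∧ ∃ k ∈ Set.Ico N M, ε / 2 < ‖x k v‖ := by
    intro N
    obtain ⟨k, hk, hkN, hNk⟩ := (hcon.and_eventually (((hproj N).eventually_lt_const
      (half_pos hε)).and (eventually_ge_atTop N))).exists
    have hlt : ε / 2 < ‖x k - (x k).comp (proj N)‖ := by
      linarith [norm_sub_norm_le (x k) ((x k).comp (proj N))]
    obtain ⟨M, hM, v, hv, hxv⟩ := exists_isBlock_lt hlt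
    exact ⟨max M (k + 1), hM.trans (le_max_left _ _), v, hv.mono (le_max_left _ _),
      k, ⟨hNk, le_max_right M (k + 1)⟩, hxv⟩
  obtain ⟨N, v, hN, hv⟩ := exists_seq_isBlock hblock
  choose k hk hxv using fun n => (hv n).2
  have hk_mono : StrictMono k := strictMono_nat_of_lt_succ fun n =>
    (hk n).2.trans_le (hk (n + 1)).1
  have hlim := hE _ _ ((hx.comp hk_mono.injective).apply (isWUC_of_isBlock hN fun n => (hv n).1))
  obtain ⟨n, hn⟩ := (hlim.norm.eventually_lt_const (u := ε / 2) (by simpa using half_pos hε)).exists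
  exact lt_asymm hn (hxv n)

end NoC0

section MultilinearForms

set_option maxSynthPendingDepth 3

theorem curryLeft_compContinuousLinearMap {X E : Type*} [NormedAddCommGroup X] [NormedSpace ℂ X]
    [NormedAddCommGroup E] [NormedSpace ℂ E] {m : ℕ} (A : X [×(m + 1)]→L[ℂ] E) (P : X →L[ℂ] X)
    (x : X) : (A.compContinuousLinearMap fun _ => P).curryLeft x =
      (A.curryLeft (P x)).compContinuousLinearMap fun _ => P := by
  ext v
  simp only [ContinuousMultilinearMap.curryLeft_apply,
    ContinuousMultilinearMap.compContinuousLinearMap_apply]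
  congr 1
  ext i : 1
  refine Fin.cases ?_ (fun j => ?_) i <;> simp

variable {E : Type*} [NormedAddCommGroup E] [NormedSpace ℂ E]

theorem HasNoC0.tendsto_comp_comp_proj (hE : HasNoC0 E) {Q : ℕ → E →L[ℂ] E}
    (hQ : ∀ N, ‖Q N‖ ≤ 1) (hlim : ∀ y, Tendsto (fun N => Q N y) atTop (𝓝 y))
    (T : C₀(ℕ, ℂ) →L[ℂ] E) :
    Tendsto (fun N => (Q N).comp (T.comp (proj N))) atTop (𝓝 T) := by
  have hQle : ∀ N (S : C₀(ℕ, ℂ) →L[ℂ] E), ‖(Q N).comp S‖ ≤ ‖S‖ := fun N S =>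
    ((Q N).opNorm_comp_le S).trans (mul_le_of_le_one_left S.opNorm_nonneg (hQ N))
  have hequi : Equicontinuous fun N (S : C₀(ℕ, ℂ) →L[ℂ] E) => (Q N).comp S :=
    (LipschitzWith.uniformEquicontinuous _ 1 fun N => LipschitzWith.mk_one fun S S' => by
      rw [dist_eq_norm, dist_eq_norm, ← ContinuousLinearMap.comp_sub]
      exact hQle N _).equicontinuous
  have hT : Tendsto (fun N => (Q N).comp T) atTop (𝓝 T) :=
    (hequi.isClosed_setOfPred_tendsto continuous_id).mem_of_tendsto (hE.tendsto_comp_proj T)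
      (Eventually.of_forall fun K =>
        tendsto_comp_proj_of_pointwise (x := fun N => (Q N).comp T) (fun u => hlim (T u)) K)
  have hdiff : Tendsto (fun N => (Q N).comp (T.comp (proj N) - T)) atTop (𝓝 0) :=
    squeeze_zero_norm (fun N => hQle N _)
      (tendsto_iff_norm_sub_tendsto_zero.1 (hE.tendsto_comp_proj T))
  simpa using hdiff.add hT

theorem HasNoC0.multilinear (hE : HasNoC0 E) (m : ℕ) : HasNoC0 (C₀(ℕ, ℂ) [×m]→L[ℂ] E) := by
  induction m with
  | zero =>
    exact hE.of_linearIsometry (continuousMultilinearCurryFin0 ℂ C₀(ℕ, ℂ) E).toLinearIsometry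
  | succ m ih =>
    exact ih.clm.of_linearIsometry
      (continuousMultilinearCurryLeftEquiv ℂ (fun _ : Fin (m + 1) => C₀(ℕ, ℂ)) E).toLinearIsometry

theorem HasNoC0.tendsto_compContinuousLinearMap_proj (hE : HasNoC0 E) (m : ℕ)
    (A : C₀(ℕ, ℂ) [×m]→L[ℂ] E) :
    Tendsto (fun N => A.compContinuousLinearMap fun _ => proj N) atTop (𝓝 A) := by
  induction m with
  | zero =>
    refine tendsto_const_nhds.congr fun N => ?_
    ext v
    exact congrArg A (Subsingleton.elim _ _)
  | succ m ih =>
    let e := continuousMultilinearCurryLeftEquiv ℂ (fun _ : Fin (m + 1) => C₀(ℕ, ℂ)) E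
    let Q : ℕ → (C₀(ℕ, ℂ) [×m]→L[ℂ] E) →L[ℂ] (C₀(ℕ, ℂ) [×m]→L[ℂ] E) := fun N =>
      ContinuousMultilinearMap.compContinuousLinearMapL fun _ => proj N
    have hQ : ∀ N, ‖Q N‖ ≤ 1 := fun N =>
      (ContinuousMultilinearMap.norm_compContinuousLinearMapL_le _ _).trans
        (Finset.prod_le_one (fun _ _ => norm_nonneg _) fun _ _ => norm_proj_le N)
    have hcurry := (e.symm.continuous.tendsto _).comp
      ((hE.multilinear m).tendsto_comp_comp_proj hQ ih (e A))
    rw [e.symm_apply_apply] at hcurry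
    refine hcurry.congr fun N => e.symm_apply_eq.2 ?_
    ext x : 1
    exact (curryLeft_compContinuousLinearMap A (proj N) x).symm

end MultilinearForms

section AronBerner

set_option maxSynthPendingDepth 3

theorem bidual_apply_comp_proj (N : ℕ) (ζ : Bidual C₀(ℕ, ℂ)) (y : StrongDual ℂ C₀(ℕ, ℂ)) :
    ζ (y.comp (proj N)) = y (trunc N ζ) := by
  rw [comp_proj_eq_sum, trunc_eq_sum, map_sum, map_sum]
  refine Finset.sum_congr rfl fun i _ => ?_
  have : (coordFun i).smulRight (y (unitVec i)) = y (unitVec i) • coordFun i := by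
    ext x
    simp [mul_comm]
  rw [this, map_smul, map_smul, smul_eq_mul, smul_eq_mul, mul_comm]

theorem aronBerner_compContinuousLinearMap_proj (m N : ℕ) (ζ : Fin m → Bidual C₀(ℕ, ℂ))
    (A : C₀(ℕ, ℂ) [×m]→L[ℂ] ℂ) :
    aronBerner m ζ (A.compContinuousLinearMap fun _ => proj N) = A fun i => trunc N (ζ i) := by
  induction m with
  | zero => exact congrArg A (Subsingleton.elim _ _)
  | succ m ih =>
    have hcurry : (aronBerner m (Fin.tail ζ)).comp
        (A.compContinuousLinearMap fun _ => proj N).curryLeft =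
        ((ContinuousMultilinearMap.apply ℂ (fun _ : Fin m => C₀(ℕ, ℂ)) ℂ
          fun i => trunc N (Fin.tail ζ i)).comp A.curryLeft).comp (proj N) := by
      ext x
      rw [ContinuousLinearMap.comp_apply, curryLeft_compContinuousLinearMap, ih]
      rfl
    rw [aronBerner_succ_apply, hcurry, bidual_apply_comp_proj]
    refine congrArg A (funext fun i => ?_)
    refine Fin.cases ?_ (fun j => ?_) i <;> simp [Fin.tail]

/- On `c₀` every bounded multilinear form is the norm limit of its restrictions to the first
coordinates, so the Aron–Berner extension does not depend on the order of the variables. -/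
theorem tendsto_aronBerner (m : ℕ) (ζ : Fin m → Bidual C₀(ℕ, ℂ)) (A : C₀(ℕ, ℂ) [×m]→L[ℂ] ℂ) :
    Tendsto (fun N => A fun i => trunc N (ζ i)) atTop (𝓝 (aronBerner m ζ A)) := by
  simp only [← aronBerner_compContinuousLinearMap_proj]
  exact ((aronBerner m ζ).continuous.tendsto A).comp
    (hasNoC0_complex.tendsto_compContinuousLinearMap_proj m A)

end AronBerner

section Taylor

variable {X Y : Type*} [NormedAddCommGroup X] [NormedSpace ℂ X] [NormedAddCommGroup Y]
  [NormedSpace ℂ Y] {F : X → Y}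

variable (F) in
/-- The `m`-homogeneous term of the Taylor series of `F` at the origin, as a multilinear map. -/
def taylorForm (m : ℕ) : X [×m]→L[ℂ] Y := (m.factorial : ℂ)⁻¹ • iteratedFDeriv ℂ m F 0

theorem iteratedDeriv_comp_smul [CompleteSpace Y] (hF : AnalyticAt ℂ F 0) (m : ℕ) (x : X) :
    iteratedDeriv m (fun t : ℂ => F (t • x)) 0 = iteratedFDeriv ℂ m F 0 fun _ => x := by
  obtain ⟨p, r, hp⟩ := hF
  let u : ℂ →L[ℂ] X := ContinuousLinearMap.toSpanSingleton ℂ x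
  have hpu : HasFPowerSeriesOnBall F p (u 0) r := by rwa [map_zero]
  have hline : iteratedFDeriv ℂ m (F ∘ u) 0 (fun _ => 1) = iteratedFDeriv ℂ m F 0 fun _ => x := by
    rw [← hpu.compContinuousLinearMap.factorial_smul 1 m, ← hp.factorial_smul x m,
      FormalMultilinearSeries.compContinuousLinearMap_apply]
    congr 2
    exact funext fun _ => one_smul ℂ x
  rw [iteratedDeriv_eq_iteratedFDeriv]
  exact hline

theorem smul_mem_ball_of_norm_lt {ρ : ℝ} {x : X} (hx : ‖x‖ < ρ) {t : ℂ}
    (ht : t ∈ closedBall (0 : ℂ) ρ⁻¹) : t • x ∈ ball (0 : X) 1 := by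
  have hρ : 0 < ρ := (norm_nonneg x).trans_lt hx
  rw [mem_closedBall_zero_iff] at ht
  rw [mem_ball_zero_iff, norm_smul]
  calc ‖t‖ * ‖x‖ ≤ ρ⁻¹ * ‖x‖ := by gcongr
    _ < ρ⁻¹ * ρ := by gcongr
    _ = 1 := inv_mul_cancel₀ hρ.ne'

theorem differentiableOn_comp_smul (hF : DifferentiableOn ℂ F (ball 0 1)) {ρ : ℝ} {x : X}
    (hx : ‖x‖ < ρ) : DifferentiableOn ℂ (fun t : ℂ => F (t • x)) (closedBall 0 ρ⁻¹) :=
  hF.comp (differentiable_id.smul_const x).differentiableOn fun _ => smul_mem_ball_of_norm_lt hx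

variable [CompleteSpace Y]

theorem hasSum_taylorForm (hF : AnalyticOnNhd ℂ F (ball 0 1)) {x : X} (hx : ‖x‖ < 1) :
    HasSum (fun m => taylorForm F m fun _ => x) (F x) := by
  obtain ⟨ρ, hxρ, hρ⟩ := exists_between hx
  have hρ₁ : 1 < ρ⁻¹ := (one_lt_inv₀ ((norm_nonneg x).trans_lt hxρ)).2 hρ
  have hsum := Complex.hasSum_taylorSeries_on_ball (z := 1)
    ((differentiableOn_comp_smul hF.differentiableOn hxρ).mono ball_subset_closedBall)
    (by simpa using hρ₁)
  simp only [sub_zero, one_pow, one_smul,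
    iteratedDeriv_comp_smul (hF 0 (mem_ball_self one_pos))] at hsum
  exact hsum

theorem norm_taylorForm_le_of_lt (hF : AnalyticOnNhd ℂ F (ball 0 1)) {C : ℝ}
    (hC : ∀ x ∈ ball (0 : X) 1, ‖F x‖ ≤ C) (m : ℕ) {x : X} {ρ : ℝ} (hx : ‖x‖ < ρ) :
    ‖taylorForm F m fun _ => x‖ ≤ C * ρ ^ m := by
  have hρ : 0 < ρ⁻¹ := inv_pos.2 ((norm_nonneg x).trans_lt hx)
  have hdiff : DiffContOnCl ℂ (fun t : ℂ => F (t • x)) (ball 0 ρ⁻¹) :=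
    DifferentiableOn.diffContOnCl <| by
      rw [closure_ball _ hρ.ne']
      exact differentiableOn_comp_smul hF.differentiableOn hx
  have hcauchy := Complex.norm_iteratedDeriv_le_of_forall_mem_sphere_norm_le m hρ hdiff
    fun t ht => hC _ (smul_mem_ball_of_norm_lt hx (sphere_subset_closedBall ht))
  rw [iteratedDeriv_comp_smul (hF 0 (mem_ball_self one_pos)), inv_pow, div_inv_eq_mul,
    mul_assoc] at hcauchy
  rw [taylorForm, _root_.smul_apply, norm_smul, norm_inv, Complex.norm_natCast]
  exact (inv_mul_le_iff₀ (by positivity)).2 hcauchy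

theorem norm_taylorForm_le (hF : AnalyticOnNhd ℂ F (ball 0 1)) {C : ℝ}
    (hC : ∀ x ∈ ball (0 : X) 1, ‖F x‖ ≤ C) (m : ℕ) (x : X) :
    ‖taylorForm F m fun _ => x‖ ≤ C * ‖x‖ ^ m := by
  have hlim : Tendsto (fun ρ : ℝ => C * ρ ^ m) (𝓝[>] ‖x‖) (𝓝 (C * ‖x‖ ^ m)) :=
    ((continuous_const.mul (continuous_pow m)).tendsto _).mono_left nhdsWithin_le_nhds
  exact ge_of_tendsto hlim
    (eventually_mem_nhdsWithin.mono fun _ => norm_taylorForm_le_of_lt hF hC m)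

end Taylor

section BallAlgebra

variable {X : Type*} [NormedAddCommGroup X] [NormedSpace ℂ X]

theorem norm_ext_le (f : Au X) (x : X) : ‖ext f.1 x‖ ≤ ‖f‖ := by
  by_cases hx : x ∈ ball (0 : X) 1
  · rw [ext_apply _ x hx]
    exact f.1.norm_coe_le_norm _
  · rw [ext, Function.extend_apply' _ _ _ (by rintro ⟨y, rfl⟩; exact hx y.2), Pi.zero_apply,
      norm_zero]
    exact norm_nonneg f

theorem norm_le_of_forall_ext_le {f : Au X} {C : ℝ} (hC : 0 ≤ C)
    (h : ∀ x ∈ ball (0 : X) 1, ‖ext f.1 x‖ ≤ C) : ‖f‖ ≤ C :=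
  (BoundedContinuousFunction.norm_le hC).2 fun x =>
    (congrArg norm (ext_apply _ x.1 x.2)).symm.trans_le (h x.1 x.2)

theorem uniformContinuousOn_ext (f : Au X) : UniformContinuousOn (ext f.1) (ball 0 1) := by
  have hrestrict : (ball (0 : X) 1).domRestrict (ext f.1) = f.1 :=
    funext fun x => ext_apply _ x.1 x.2
  rw [uniformContinuousOn_iff_restrict, hrestrict]
  exact f.2.2

/-- The element of `𝒜ᵤ(B_X)` given by a function on `X` that is analytic, uniformly continuous and
bounded on the open unit ball. -/
def mkAu (F : X → ℂ) (hF : AnalyticOnNhd ℂ F (ball 0 1)) (hu : UniformContinuousOn F (ball 0 1))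
    (C : ℝ) (hC : ∀ x ∈ ball (0 : X) 1, ‖F x‖ ≤ C) : Au X :=
  ⟨BoundedContinuousFunction.ofNormedAddCommGroup (fun x : ball (0 : X) 1 => F x)
      (uniformContinuousOn_iff_restrict.1 hu).continuous C fun x => hC x x.2,
    hF.congr isOpen_ball fun x hx => by rw [ext_apply _ x hx]; rfl,
    uniformContinuousOn_iff_restrict.1 hu⟩

theorem ext_mkAu {F : X → ℂ} (hF : AnalyticOnNhd ℂ F (ball 0 1))
    (hu : UniformContinuousOn F (ball 0 1)) (C : ℝ) (hC : ∀ x ∈ ball (0 : X) 1, ‖F x‖ ≤ C) :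
    Set.EqOn (ext (mkAu F hF hu C hC).1) F (ball 0 1) := fun x hx => by
  rw [ext_apply _ x hx]
  rfl

/-- Evaluation at a point of the open unit ball, as a point of the spectrum. -/
def ballEval (x : ball (0 : X) 1) : Spec X :=
  ⟨StrongDual.toWeakDual
      ((BoundedContinuousFunction.evalCLM ℂ x).comp (Au X).toSubmodule.subtypeL),
    fun h => one_ne_zero (α := ℂ) (DFunLike.congr_fun h 1), fun _ _ => rfl⟩

theorem ballEval_apply {x : X} (hx : x ∈ ball (0 : X) 1) (f : Au X) :
    ballEval ⟨x, hx⟩ f = ext f.1 x :=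
  (ext_apply _ x hx).symm

theorem eq_of_forall_ballEval_eq {f g : Au X} (h : ∀ x, ballEval x f = ballEval x g) : f = g :=
  Subtype.ext (DFunLike.ext _ _ h)

theorem norm_spec_apply_le (φ : Spec X) (f : Au X) : ‖φ f‖ ≤ ‖f‖ := by
  have hφ : (φ : Au X →+* ℂ).IsBounded :=
    ⟨‖WeakDual.toStrongDual φ.1‖ + 1, by positivity, fun g =>
      ((WeakDual.toStrongDual φ.1).le_opNorm g).trans
        (mul_le_mul_of_nonneg_right (by linarith) (norm_nonneg g))⟩
  exact contraction_of_isPowMul (fun z {n} _ => norm_pow z n) hφ f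

theorem isClosed_image_characterSpace :
    IsClosed (DFunLike.coe '' WeakDual.characterSpace ℂ (Au X) : Set (Au X → ℂ)) := by
  refine WeakDual.isClosed_image_coe_of_bounded_of_closed ?_ WeakDual.CharacterSpace.isClosed
  refine (WeakDual.isBounded_closedBall 0 1).subset fun φ hφ => mem_closedBall_zero_iff.2 ?_
  exact ContinuousLinearMap.opNorm_le_bound _ zero_le_one fun f =>
    (norm_spec_apply_le ⟨φ, hφ⟩ f).trans_eq (one_mul _).symm

theorem exists_spec_of_tendsto_ext {ι : Type*} {l : Filter ι} [l.NeBot] {p : ι → X}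
    (hp : ∀ᶠ i in l, p i ∈ ball (0 : X) 1) {L : Au X → ℂ}
    (h : ∀ f : Au X, Tendsto (fun i => ext f.1 (p i)) l (𝓝 (L f))) :
    ∃ φ : Spec X, ∀ f, φ f = L f := by
  obtain ⟨φ, hφ, rfl⟩ := isClosed_image_characterSpace.mem_of_tendsto (tendsto_pi_nhds.2 h)
    (hp.mono fun i hi => ⟨ballEval ⟨p i, hi⟩, (ballEval _).2, funext (ballEval_apply hi)⟩)
  exact ⟨⟨φ, hφ⟩, fun _ => rfl⟩

end BallAlgebra

section Boundary

variable {E : Type*} [NormedAddCommGroup E] [NormedSpace ℂ E] {a : E}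

theorem norm_ofReal_smul_lt_one {r : ℝ} (hr : r ∈ Set.Ioo (0 : ℝ) 1) (ha : ‖a‖ ≤ 1) :
    ‖(r : ℂ) • a‖ < 1 := by
  rw [norm_smul, Complex.norm_real, Real.norm_of_nonneg hr.1.le]
  exact (mul_le_of_le_one_right hr.1.le ha).trans_lt hr.2

theorem tendsto_ofReal_smul (a : E) :
    Tendsto (fun r : ℝ => (r : ℂ) • a) (𝓝[<] 1) (𝓝 a) := by
  have hcont : Continuous fun r : ℝ => (r : ℂ) • a := by fun_prop
  simpa using (hcont.tendsto 1).mono_left nhdsWithin_le_nhds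

theorem eventually_ofReal_smul_mem_ball (ha : ‖a‖ ≤ 1) :
    ∀ᶠ r : ℝ in 𝓝[<] 1, (r : ℂ) • a ∈ ball (0 : E) 1 :=
  mem_of_superset (Ioo_mem_nhdsLT zero_lt_one) fun _ hr =>
    mem_ball_zero_iff.2 (norm_ofReal_smul_lt_one hr ha)

theorem tendsto_extendFrom_ball {g : E → ℂ} (hg : UniformContinuousOn g (ball 0 1))
    (ha : ‖a‖ ≤ 1) :
    Tendsto (fun r : ℝ => g ((r : ℂ) • a)) (𝓝[<] 1) (𝓝 (extendFrom (ball 0 1) g a)) := by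
  have hne : (𝓝[ball (0 : E) 1] a).NeBot := by
    rw [← mem_closure_iff_nhdsWithin_neBot, closure_ball _ one_ne_zero]
    exact mem_closedBall_zero_iff.2 ha
  have hcauchy : Cauchy ((𝓝[ball (0 : E) 1] a).map g) :=
    (cauchy_nhds.mono nhdsWithin_le_nhds).map_of_le hg inf_le_right
  exact (tendsto_extendFrom (cauchy_map_iff_exists_tendsto.1 hcauchy)).comp
    (tendsto_nhdsWithin_iff.2 ⟨tendsto_ofReal_smul a, eventually_ofReal_smul_mem_ball ha⟩)

theorem tendsto_evalClosed (f : Au E) (ha : ‖a‖ ≤ 1) :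
    Tendsto (fun r : ℝ => ext f.1 ((r : ℂ) • a)) (𝓝[<] 1) (𝓝 (evalClosed f a)) :=
  tendsto_extendFrom_ball (uniformContinuousOn_ext f) ha

theorem evalClosed_eq_of_continuousAt {f : Au E} (ha : ‖a‖ ≤ 1) {F : E → ℂ}
    (hf : Set.EqOn (ext f.1) F (ball 0 1)) (hF : ContinuousAt F a) : evalClosed f a = F a :=
  tendsto_nhds_unique (tendsto_evalClosed f ha) <|
    (hF.tendsto.comp (tendsto_ofReal_smul a)).congr'
      ((eventually_ofReal_smul_mem_ball ha).mono fun _ hr => (hf hr).symm)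

theorem exists_spec_evalClosed (ha : ‖a‖ ≤ 1) : ∃ φ : Spec E, ∀ f, φ f = evalClosed f a :=
  exists_spec_of_tendsto_ext (eventually_ofReal_smul_mem_ball ha) fun f => tendsto_evalClosed f ha

end Boundary

section CanonicalExtension

set_option maxSynthPendingDepth 3

theorem curry_neBot {α β : Type*} {l : Filter α} {m : Filter β} [l.NeBot] [m.NeBot] :
    (l.curry m).NeBot := by
  rw [neBot_iff, Ne, ← eventually_false_iff_eq_bot, eventually_curry_iff]
  simp only [eventually_const, not_false_eq_true]

theorem tendsto_curry {α β Y : Type*} [TopologicalSpace Y] {l : Filter α} {m : Filter β}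
    {f : α × β → Y} {g : α → Y} {y : Y}
    (hf : ∀ᶠ a in l, Tendsto (fun b => f (a, b)) m (𝓝 (g a))) (hg : Tendsto g l (𝓝 y)) :
    Tendsto f (l.curry m) (𝓝 y) := by
  refine (nhds_basis_opens y).tendsto_right_iff.2 fun U ⟨hyU, hU⟩ => eventually_curry_iff.2 ?_
  filter_upwards [hf, hg (hU.mem_nhds hyU)] with a ha hga
  exact ha (hU.mem_nhds hga)

theorem tendsto_canonicalExt (f : Au C₀(ℕ, ℂ)) {ζ : Bidual C₀(ℕ, ℂ)} (hζ : ‖ζ‖ < 1) :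
    Tendsto (fun N => ext f.1 (trunc N ζ)) atTop (𝓝 (canonicalExt f ζ)) := by
  have hsum : Tendsto (fun N => ∑' m, taylorForm (ext f.1) m fun _ => trunc N ζ) atTop
      (𝓝 (canonicalExt f ζ)) := by
    refine tendsto_tsum_of_dominated_convergence (bound := fun m => ‖f‖ * ‖ζ‖ ^ m)
      ((summable_geometric_of_lt_one ζ.opNorm_nonneg hζ).mul_left _)
      (fun m => tendsto_aronBerner m (fun _ => ζ) _) (Eventually.of_forall fun N m => ?_)
    refine (norm_taylorForm_le f.2.1 (fun x _ => norm_ext_le f x) m _).trans ?_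
    gcongr
    exact norm_trunc_le N ζ
  exact hsum.congr fun N => (hasSum_taylorForm f.2.1 ((norm_trunc_le N ζ).trans_lt hζ)).tsum_eq

theorem uniformContinuousOn_canonicalExt (f : Au C₀(ℕ, ℂ)) :
    UniformContinuousOn (canonicalExt f) (ball 0 1) := by
  rw [Metric.uniformContinuousOn_iff_le]
  intro ε hε
  obtain ⟨d, hd, hf⟩ := Metric.uniformContinuousOn_iff_le.1 (uniformContinuousOn_ext f) ε hε
  have htrunc : ∀ N, ∀ ζ ∈ ball (0 : Bidual C₀(ℕ, ℂ)) 1, trunc N ζ ∈ ball (0 : C₀(ℕ, ℂ)) 1 :=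
    fun N ζ hζ => mem_ball_zero_iff.2 ((norm_trunc_le N ζ).trans_lt (mem_ball_zero_iff.1 hζ))
  refine ⟨d, hd, fun ζ hζ ξ hξ hd => ?_⟩
  refine le_of_tendsto ((tendsto_canonicalExt f (mem_ball_zero_iff.1 hζ)).dist
    (tendsto_canonicalExt f (mem_ball_zero_iff.1 hξ)))
    (Eventually.of_forall fun N => hf _ (htrunc N ζ hζ) _ (htrunc N ξ hξ) ?_)
  rw [dist_eq_norm, ← map_sub]
  exact (norm_trunc_le N _).trans ((dist_eq_norm ζ ξ).symm.trans_le hd)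

variable {ζ : Bidual C₀(ℕ, ℂ)}

theorem eventually_smul_trunc_mem_ball (hζ : ‖ζ‖ ≤ 1) :
    ∀ᶠ p : ℝ × ℕ in (𝓝[<] 1).curry atTop, (p.1 : ℂ) • trunc p.2 ζ ∈ ball (0 : C₀(ℕ, ℂ)) 1 :=
  eventually_curry_iff.2 <| mem_of_superset (Ioo_mem_nhdsLT zero_lt_one) fun _ hr =>
    Eventually.of_forall fun N => mem_ball_zero_iff.2
      (norm_ofReal_smul_lt_one hr ((norm_trunc_le N ζ).trans hζ))

theorem tendsto_canonicalExtClosed (f : Au C₀(ℕ, ℂ)) (hζ : ‖ζ‖ ≤ 1) :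
    Tendsto (fun p : ℝ × ℕ => ext f.1 ((p.1 : ℂ) • trunc p.2 ζ)) ((𝓝[<] 1).curry atTop)
      (𝓝 (canonicalExtClosed f ζ)) := by
  refine tendsto_curry ?_ (tendsto_extendFrom_ball (uniformContinuousOn_canonicalExt f) hζ)
  filter_upwards [eventually_ofReal_smul_mem_ball hζ] with r hr
  simpa only [map_smul] using tendsto_canonicalExt f (mem_ball_zero_iff.1 hr)

theorem tendsto_apply_trunc (ζ : Bidual C₀(ℕ, ℂ)) (y : StrongDual ℂ C₀(ℕ, ℂ)) :
    Tendsto (fun N => y (trunc N ζ)) atTop (𝓝 (ζ y)) := by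
  simp only [← bidual_apply_comp_proj]
  exact (ζ.continuous.tendsto y).comp (hasNoC0_complex.tendsto_comp_proj y)

theorem canonicalExtClosed_eq_of_eqOn_dual {f : Au C₀(ℕ, ℂ)} (hζ : ‖ζ‖ ≤ 1)
    {y : StrongDual ℂ C₀(ℕ, ℂ)} (hf : Set.EqOn (ext f.1) y (ball 0 1)) :
    canonicalExtClosed f ζ = ζ y := by
  have := curry_neBot (l := 𝓝[<] (1 : ℝ)) (m := (atTop : Filter ℕ))
  have hy : Tendsto (fun p : ℝ × ℕ => y ((p.1 : ℂ) • trunc p.2 ζ)) ((𝓝[<] 1).curry atTop)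
      (𝓝 (ζ y)) := by
    refine tendsto_curry (Eventually.of_forall fun r => ?_) (tendsto_ofReal_smul (ζ y))
    simpa only [map_smul] using (tendsto_apply_trunc ζ y).const_smul (r : ℂ)
  refine tendsto_nhds_unique (tendsto_canonicalExtClosed f hζ) (hy.congr' ?_)
  exact (eventually_smul_trunc_mem_ball hζ).mono fun _ hp => (hf hp).symm

theorem exists_spec_canonicalExtClosed (hζ : ‖ζ‖ ≤ 1) :
    ∃ φ : Spec C₀(ℕ, ℂ), ∀ f, φ f = canonicalExtClosed f ζ :=
  have := curry_neBot (l := 𝓝[<] (1 : ℝ)) (m := (atTop : Filter ℕ))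
  exists_spec_of_tendsto_ext (eventually_smul_trunc_mem_ball hζ) fun f =>
    tendsto_canonicalExtClosed f hζ

end CanonicalExtension

section Mobius

/-- The involutive Möbius transformation of the disc that exchanges `0` and `a`. Its modulus at `b`
is the pseudo-hyperbolic distance of `a` and `b`, also on the closed disc; it vanishes for
`a = b` with `‖a‖ = 1`, where the quotient is `0 / 0`. -/
def mobius (a ζ : ℂ) : ℂ := (a - ζ) / (1 - starRingEnd ℂ a * ζ)

variable {a b : ℂ}

@[simp]
theorem mobius_zero (a : ℂ) : mobius a 0 = a := by simp [mobius]

@[simp]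
theorem mobius_self (a : ℂ) : mobius a a = 0 := by simp [mobius]

theorem norm_mobius_comm (a b : ℂ) : ‖mobius a b‖ = ‖mobius b a‖ := by
  rw [mobius, mobius, norm_div, norm_div, norm_sub_rev a b,
    ← RCLike.norm_conj (1 - starRingEnd ℂ a * b)]
  simp [mul_comm]

theorem norm_one_sub_conj_mul_sq (a b : ℂ) :
    ‖1 - starRingEnd ℂ a * b‖ ^ 2 = ‖a - b‖ ^ 2 + (1 - ‖a‖ ^ 2) * (1 - ‖b‖ ^ 2) := by
  simp only [← Complex.normSq_eq_norm_sq, Complex.normSq_apply, Complex.sub_re, Complex.sub_im,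
    Complex.one_re, Complex.one_im, Complex.mul_re, Complex.mul_im, Complex.conj_re,
    Complex.conj_im]
  ring

theorem norm_sub_le_norm_one_sub_conj_mul (ha : ‖a‖ ≤ 1) (hb : ‖b‖ ≤ 1) :
    ‖a - b‖ ≤ ‖1 - starRingEnd ℂ a * b‖ := by
  have hprod : 0 ≤ (1 - ‖a‖ ^ 2) * (1 - ‖b‖ ^ 2) :=
    mul_nonneg (sub_nonneg.2 (pow_le_one₀ (norm_nonneg a) ha))
      (sub_nonneg.2 (pow_le_one₀ (norm_nonneg b) hb))
  refine le_of_sq_le_sq ?_ (norm_nonneg _)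
  linarith [norm_one_sub_conj_mul_sq a b]

theorem norm_mobius_le_one (ha : ‖a‖ ≤ 1) (hb : ‖b‖ ≤ 1) : ‖mobius a b‖ ≤ 1 := by
  rw [mobius, norm_div]
  exact div_le_one_of_le₀ (norm_sub_le_norm_one_sub_conj_mul ha hb) (norm_nonneg _)

theorem norm_mobius_eq_one (ha : ‖a‖ = 1) (hab : a ≠ b) : ‖mobius a b‖ = 1 := by
  have hnorm : ‖1 - starRingEnd ℂ a * b‖ = ‖a - b‖ :=
    (sq_eq_sq₀ (norm_nonneg _) (norm_nonneg _)).1 <| by rw [norm_one_sub_conj_mul_sq, ha]; ring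
  rw [mobius, norm_div, hnorm, div_self (norm_ne_zero_iff.2 (sub_ne_zero.2 hab))]

theorem one_sub_conj_mul_ne_zero (ha : ‖a‖ < 1) (hb : ‖b‖ ≤ 1) :
    1 - starRingEnd ℂ a * b ≠ 0 := fun h => by
  have hone : ‖a‖ * ‖b‖ = 1 := by
    rw [← RCLike.norm_conj a, ← norm_mul, ← sub_eq_zero.1 h, norm_one]
  exact ((mul_le_of_le_one_right (norm_nonneg a) hb).trans_lt ha).ne hone

theorem one_sub_conj_mul_ne_zero_of_ne (ha : ‖a‖ ≤ 1) (hb : ‖b‖ ≤ 1) (hab : a ≠ b) :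
    1 - starRingEnd ℂ a * b ≠ 0 :=
  norm_pos_iff.1 ((norm_pos_iff.2 (sub_ne_zero.2 hab)).trans_le
    (norm_sub_le_norm_one_sub_conj_mul ha hb))

theorem mobius_mobius (ha : ‖a‖ < 1) (hb : ‖b‖ ≤ 1) : mobius a (mobius a b) = b := by
  have hne : 1 - starRingEnd ℂ a * b ≠ 0 := one_sub_conj_mul_ne_zero ha hb
  have hne_self : 1 - starRingEnd ℂ a * a ≠ 0 := one_sub_conj_mul_ne_zero ha ha.le
  have hnum : a - mobius a b = b * (1 - starRingEnd ℂ a * a) / (1 - starRingEnd ℂ a * b) := by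
    rw [mobius, eq_div_iff hne, sub_mul, div_mul_cancel₀ _ hne]
    ring
  have hden : 1 - starRingEnd ℂ a * mobius a b =
      (1 - starRingEnd ℂ a * a) / (1 - starRingEnd ℂ a * b) := by
    rw [mobius, eq_div_iff hne, sub_mul, mul_assoc, div_mul_cancel₀ _ hne]
    ring
  rw [mobius, hnum, hden, div_div_div_cancel_right₀ hne, mul_div_cancel_right₀ _ hne_self]

theorem analyticAt_mobius (ha : ‖a‖ < 1) (hb : ‖b‖ ≤ 1) : AnalyticAt ℂ (mobius a) b :=
  (analyticAt_const.sub analyticAt_id).div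
    (analyticAt_const.sub (analyticAt_const.mul analyticAt_id)) (one_sub_conj_mul_ne_zero ha hb)

theorem uniformContinuousOn_mobius (ha : ‖a‖ < 1) :
    UniformContinuousOn (mobius a) (closedBall 0 1) :=
  (isCompact_closedBall (0 : ℂ) 1).uniformContinuousOn_of_continuous fun _ hb =>
    (analyticAt_mobius ha (mem_closedBall_zero_iff.1 hb)).continuousAt.continuousWithinAt

theorem mul_norm_one_sub_lt {w : ℂ} (hw : ‖w‖ ≤ 1) {r : ℝ} (hr : r ∈ Set.Ioo (0 : ℝ) 1) :
    r * ‖1 - w‖ < ‖1 - (r : ℂ) ^ 2 * w‖ := by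
  have hsq : ‖1 - (r : ℂ) ^ 2 * w‖ ^ 2 - (r * ‖1 - w‖) ^ 2 =
      (1 - r ^ 2) * (1 - r ^ 2 * ‖w‖ ^ 2) := by
    rw [mul_pow, ← Complex.ofReal_pow]
    simp only [← Complex.normSq_eq_norm_sq, Complex.normSq_apply, Complex.sub_re, Complex.sub_im,
      Complex.one_re, Complex.one_im, Complex.re_ofReal_mul, Complex.im_ofReal_mul]
    ring
  have hr₂ : r ^ 2 < 1 := pow_lt_one₀ hr.1.le hr.2 two_ne_zero
  have hw₂ : r ^ 2 * ‖w‖ ^ 2 < 1 :=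
    (mul_le_of_le_one_right (sq_nonneg r) (pow_le_one₀ (norm_nonneg w) hw)).trans_lt hr₂
  refine lt_of_pow_lt_pow_left₀ 2 (norm_nonneg _) (sub_pos.1 ?_)
  rw [hsq]
  exact mul_pos (sub_pos.2 hr₂) (sub_pos.2 hw₂)

theorem mobius_ofReal_mul (a b : ℂ) (r : ℝ) :
    mobius (r * a) (r * b) = r * (a - b) / (1 - (r : ℂ) ^ 2 * (starRingEnd ℂ a * b)) := by
  rw [mobius, map_mul, Complex.conj_ofReal]
  ring_nf

theorem norm_mobius_ofReal_mul_lt (ha : ‖a‖ ≤ 1) (hb : ‖b‖ ≤ 1) (hab : a ≠ b) {r : ℝ}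
    (hr : r ∈ Set.Ioo (0 : ℝ) 1) : ‖mobius (r * a) (r * b)‖ < ‖mobius a b‖ := by
  have hw : ‖starRingEnd ℂ a * b‖ ≤ 1 := by
    rw [norm_mul, RCLike.norm_conj]
    exact mul_le_one₀ ha (norm_nonneg b) hb
  have hlt := mul_norm_one_sub_lt hw hr
  have hpos : 0 < ‖1 - starRingEnd ℂ a * b‖ :=
    norm_pos_iff.2 (one_sub_conj_mul_ne_zero_of_ne ha hb hab)
  rw [mobius_ofReal_mul, mobius, norm_div, norm_div, norm_mul, Complex.norm_real,
    Real.norm_of_nonneg hr.1.le,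
    div_lt_div_iff₀ ((mul_nonneg hr.1.le hpos.le).trans_lt hlt) hpos, mul_right_comm, mul_comm]
  exact mul_lt_mul_of_pos_left hlt (norm_pos_iff.2 (sub_ne_zero.2 hab))

theorem exists_analytic_disc (ha : ‖a‖ ≤ 1) (hb : ‖b‖ ≤ 1) {s : ℝ} (hs : s < 1)
    (hab : ‖mobius a b‖ ≤ s) :
    ∃ Φ : ℂ → ℂ, DifferentiableOn ℂ Φ (ball 0 1) ∧
      Set.MapsTo Φ (ball 0 1) (closedBall 0 1) ∧ Φ s = a ∧ Φ 0 = b := by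
  rcases hb.lt_or_eq with hb | hb
  · have hs₀ : 0 ≤ s := (norm_nonneg _).trans hab
    rw [norm_mobius_comm] at hab
    let c : ℂ := mobius b a / s
    have hc : ‖c‖ ≤ 1 := by
      rw [norm_div, Complex.norm_real, Real.norm_of_nonneg hs₀]
      exact div_le_one_of_le₀ hab hs₀
    have hcs : c * s = mobius b a := div_mul_cancel_of_imp fun h => by
      rwa [Complex.ofReal_eq_zero.1 h, norm_le_zero_iff] at hab
    have hcζ : ∀ ζ ∈ ball (0 : ℂ) 1, ‖c * ζ‖ ≤ 1 := fun ζ hζ => by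
      rw [norm_mul]
      exact mul_le_one₀ hc (norm_nonneg ζ) (mem_ball_zero_iff.1 hζ).le
    refine ⟨fun ζ => mobius b (c * ζ), fun ζ hζ => ?_, fun ζ hζ => ?_, ?_, ?_⟩
    · exact ((analyticAt_mobius hb (hcζ ζ hζ)).differentiableAt.comp ζ
        (differentiableAt_id.const_mul c)).differentiableWithinAt
    · exact mem_closedBall_zero_iff.2 (norm_mobius_le_one hb.le (hcζ ζ hζ))
    · simp only [hcs, mobius_mobius hb ha]
    · simp only [mul_zero, mobius_zero]
  · have heq : b = a := by
      by_contra hne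
      rw [norm_mobius_comm, norm_mobius_eq_one hb hne] at hab
      exact hs.not_ge hab
    exact ⟨fun _ => b, differentiableOn_const b, fun _ _ => mem_closedBall_zero_iff.2 hb.le,
      heq, rfl⟩

end Mobius

section Gleason

variable {X Y ι : Type*} [NormedAddCommGroup X] [NormedSpace ℂ X] [NormedAddCommGroup Y]
  [NormedSpace ℂ Y] {φ ψ : Spec X} {f : Au X}

theorem norm_spec_apply_le_one (φ : Spec X) (hf : ‖f‖ ≤ 1) : ‖φ f‖ ≤ 1 :=
  (norm_spec_apply_le φ f).trans hf

theorem le_rho (hf : ‖f‖ ≤ 1) (h : ψ f = 0) : ‖φ f‖ ≤ rho φ ψ :=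
  le_csSup ⟨1, by rintro _ ⟨g, hg, _, rfl⟩; exact norm_spec_apply_le_one φ hg⟩ ⟨f, hf, h, rfl⟩

theorem rho_le {C : ℝ} (h : ∀ f : Au X, ‖f‖ ≤ 1 → ψ f = 0 → ‖φ f‖ ≤ C) : rho φ ψ ≤ C :=
  csSup_le ⟨‖φ 0‖, 0, norm_zero.trans_le zero_le_one, map_zero ψ, rfl⟩
    fun _ ⟨f, hf, hψ, ht⟩ => ht.trans_le (h f hf hψ)

theorem rho_le_one (φ ψ : Spec X) : rho φ ψ ≤ 1 :=
  rho_le fun _ hf _ => norm_spec_apply_le_one φ hf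

theorem rho_nonneg (φ ψ : Spec X) : 0 ≤ rho φ ψ :=
  (norm_nonneg _).trans (le_rho (f := 0) (norm_zero.trans_le zero_le_one) (map_zero ψ))

theorem exists_norm_gt_of_lt_rho {t : ℝ} (h : t < rho φ ψ) :
    ∃ f : Au X, ‖f‖ ≤ 1 ∧ ψ f = 0 ∧ t < ‖φ f‖ := by
  by_contra! hle
  exact h.not_ge (rho_le hle)

theorem norm_sub_le_gleasonDist (φ ψ : Spec X) (hf : ‖f‖ ≤ 1) : ‖φ f - ψ f‖ ≤ gleasonDist φ ψ :=
  ((WeakDual.toStrongDual φ.1 - WeakDual.toStrongDual ψ.1).le_opNorm_of_le hf).trans_eq (mul_one _)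

theorem gleasonDist_le {C : ℝ} (hC : 0 ≤ C) (h : ∀ f : Au X, ‖f‖ ≤ 1 → ‖φ f - ψ f‖ ≤ C) :
    gleasonDist φ ψ ≤ C :=
  ContinuousLinearMap.opNorm_le_of_unit_norm hC fun f hf => h f hf.le

theorem gleasonDist_nonneg (φ ψ : Spec X) : 0 ≤ gleasonDist φ ψ :=
  ContinuousLinearMap.opNorm_nonneg _

theorem gleasonDist_le_two (φ ψ : Spec X) : gleasonDist φ ψ ≤ 2 :=
  gleasonDist_le zero_le_two fun _ hf => (norm_sub_le _ _).trans
    (by linarith [norm_spec_apply_le_one φ hf, norm_spec_apply_le_one ψ hf])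

theorem exists_forall_spec_apply_eq_mobius {b : ℂ} (hb : ‖b‖ < 1) (hf : ‖f‖ ≤ 1) :
    ∃ h : Au X, ‖h‖ ≤ 1 ∧ ∀ φ : Spec X, φ h = mobius b (φ f) := by
  have hf₁ : ∀ x, ‖ext f.1 x‖ ≤ 1 := fun x => (norm_ext_le f x).trans hf
  have hmob : ∀ x ∈ ball (0 : X) 1, ‖mobius b (ext f.1 x)‖ ≤ 1 := fun x _ =>
    norm_mobius_le_one hb.le (hf₁ x)
  have hana : AnalyticOnNhd ℂ (fun x => mobius b (ext f.1 x)) (ball 0 1) := fun x hx =>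
    (analyticAt_mobius hb (hf₁ x)).comp (f.2.1 x hx)
  have huc : UniformContinuousOn (fun x => mobius b (ext f.1 x)) (ball 0 1) :=
    (uniformContinuousOn_mobius hb).comp (uniformContinuousOn_ext f) fun x _ =>
      mem_closedBall_zero_iff.2 (hf₁ x)
  let h : Au X := mkAu _ hana huc 1 hmob
  have hext : Set.EqOn (ext h.1) (fun x => mobius b (ext f.1 x)) (ball 0 1) := ext_mkAu _ _ _ _
  have hmul : h * (1 - starRingEnd ℂ b • f) = b • 1 - f := by
    refine eq_of_forall_ballEval_eq fun x => ?_
    simp only [map_mul, map_sub, map_smul, map_one, smul_eq_mul, mul_one]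
    rw [ballEval_apply x.2, ballEval_apply x.2, hext x.2]
    exact div_mul_cancel₀ _ (one_sub_conj_mul_ne_zero hb (hf₁ x))
  refine ⟨h, norm_le_of_forall_ext_le zero_le_one fun x hx => ?_, fun φ => ?_⟩
  · rw [hext hx]
    exact hmob x hx
  · rw [mobius, eq_div_iff (one_sub_conj_mul_ne_zero hb (norm_spec_apply_le_one φ hf))]
    simpa only [map_mul, map_sub, map_one, map_smul, smul_eq_mul, mul_one] using congrArg φ hmul

theorem norm_mobius_le_rho (φ ψ : Spec X) (hf : ‖f‖ ≤ 1) : ‖mobius (φ f) (ψ f)‖ ≤ rho φ ψ := by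
  have hstrict : ∀ g : Au X, ‖g‖ ≤ 1 → ‖ψ g‖ < 1 → ‖mobius (φ g) (ψ g)‖ ≤ rho φ ψ :=
    fun g hg hψ => by
      obtain ⟨h, hh, happly⟩ := exists_forall_spec_apply_eq_mobius hψ hg
      rw [norm_mobius_comm, ← happly φ]
      exact le_rho hh (by rw [happly ψ, mobius_self])
  rcases eq_or_ne (φ f) (ψ f) with heq | hne
  · rw [heq, mobius_self, norm_zero]
    exact rho_nonneg φ ψ
  have hcont : ContinuousAt (fun r : ℝ => mobius (r * φ f) (r * ψ f)) 1 := by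
    simp only [mobius_ofReal_mul]
    refine ContinuousAt.div (by fun_prop) (by fun_prop) ?_
    simpa using one_sub_conj_mul_ne_zero_of_ne (norm_spec_apply_le_one φ hf)
      (norm_spec_apply_le_one ψ hf) hne
  have htendsto : Tendsto (fun r : ℝ => ‖mobius (r * φ f) (r * ψ f)‖) (𝓝[<] 1)
      (𝓝 ‖mobius (φ f) (ψ f)‖) := by
    simpa using hcont.norm.tendsto.mono_left nhdsWithin_le_nhds
  refine le_of_tendsto htendsto ?_
  filter_upwards [Ioo_mem_nhdsLT zero_lt_one] with r hr
  have hrf : ‖(r : ℂ) • f‖ < 1 := norm_ofReal_smul_lt_one hr hf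
  simpa only [map_smul, smul_eq_mul] using
    hstrict ((r : ℂ) • f) hrf.le ((norm_spec_apply_le ψ _).trans_lt hrf)

theorem norm_sub_le_gleasonDist_of_norm_mobius_lt {a b : ℂ} (ha : ‖a‖ ≤ 1) (hb : ‖b‖ < 1)
    (h : ‖mobius a b‖ < rho φ ψ) : ‖a - b‖ ≤ gleasonDist φ ψ := by
  rw [norm_mobius_comm] at h
  obtain ⟨f, hf, hψ, hφ⟩ := exists_norm_gt_of_lt_rho h
  have hφ₀ : φ f ≠ 0 := norm_pos_iff.1 ((norm_nonneg _).trans_lt hφ)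
  let c : ℂ := mobius b a / φ f
  have hc : ‖c‖ ≤ 1 := by
    rw [norm_div]
    exact div_le_one_of_le₀ hφ.le (norm_nonneg _)
  have hcf : ‖c • f‖ ≤ 1 := by
    rw [norm_smul]
    exact mul_le_one₀ hc (norm_nonneg _) hf
  obtain ⟨g, hg, happly⟩ := exists_forall_spec_apply_eq_mobius hb hcf
  have hφg : φ g = a := by
    rw [happly, map_smul, smul_eq_mul, div_mul_cancel₀ _ hφ₀, mobius_mobius hb ha]
  have hψg : ψ g = b := by rw [happly, map_smul, hψ, smul_zero, mobius_zero]
  rw [← hφg, ← hψg]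
  exact norm_sub_le_gleasonDist φ ψ hg

theorem gleasonDist_le_of_forall_norm_mobius_lt {C : ℝ} (hC : 0 ≤ C)
    (h : ∀ a b : ℂ, ‖a‖ ≤ 1 → ‖b‖ < 1 → ‖mobius a b‖ < rho φ ψ → ‖a - b‖ ≤ C) :
    gleasonDist φ ψ ≤ C := by
  refine gleasonDist_le hC fun f hf => ?_
  have hφ := norm_spec_apply_le_one φ hf
  have hψ := norm_spec_apply_le_one ψ hf
  rcases eq_or_ne (φ f) (ψ f) with heq | hne
  · rwa [heq, sub_self, norm_zero]
  refine le_of_tendsto (tendsto_ofReal_smul (φ f - ψ f)).norm ?_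
  filter_upwards [Ioo_mem_nhdsLT zero_lt_one] with r hr
  rw [smul_sub]
  exact h _ _ (norm_ofReal_smul_lt_one hr hφ).le (norm_ofReal_smul_lt_one hr hψ)
    ((norm_mobius_ofReal_mul_lt hφ hψ hne hr).trans_le (norm_mobius_le_rho φ ψ hf))

theorem gleasonDist_eq_iSup_of_rho_eq_iSup [Nonempty ι] {φ' ψ' : ι → Spec Y}
    (h : rho φ ψ = ⨆ i, rho (φ' i) (ψ' i)) :
    gleasonDist φ ψ = ⨆ i, gleasonDist (φ' i) (ψ' i) := by
  have hrho : BddAbove (Set.range fun i => rho (φ' i) (ψ' i)) :=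
    ⟨1, Set.forall_mem_range.2 fun i => rho_le_one _ _⟩
  have hgleason : BddAbove (Set.range fun i => gleasonDist (φ' i) (ψ' i)) :=
    ⟨2, Set.forall_mem_range.2 fun i => gleasonDist_le_two _ _⟩
  refine le_antisymm ?_ (ciSup_le fun i => ?_)
  · refine gleasonDist_le_of_forall_norm_mobius_lt
      (Real.iSup_nonneg fun i => gleasonDist_nonneg _ _) fun a b ha hb hab => ?_
    obtain ⟨i, hi⟩ := exists_lt_of_lt_ciSup (hab.trans_eq h)
    exact (norm_sub_le_gleasonDist_of_norm_mobius_lt ha hb hi).trans (le_ciSup hgleason i)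
  · refine gleasonDist_le_of_forall_norm_mobius_lt (gleasonDist_nonneg _ _) fun a b ha hb hab => ?_
    exact norm_sub_le_gleasonDist_of_norm_mobius_lt ha hb
      (hab.trans_le ((le_ciSup hrho i).trans_eq h.symm))

end Gleason

section AnalyticDiscs

variable {X ι : Type*} [NormedAddCommGroup X] [NormedSpace ℂ X] {φ ψ : Spec X} {s : ℝ}

theorem norm_sub_le_of_analytic_disc {Φ : ℂ → X} (hΦ : DifferentiableOn ℂ Φ (ball 0 1))
    (hmaps : Set.MapsTo Φ (ball 0 1) (ball 0 1)) {f : Au X} (hf : ‖f‖ ≤ 1) {t : ℂ}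
    (ht : t ∈ ball (0 : ℂ) 1) :
    ‖ext f.1 (Φ t) - ext f.1 (Φ 0)‖ ≤ (1 + ‖ext f.1 (Φ 0)‖) * ‖t‖ := by
  have hdiff : DifferentiableOn ℂ (fun t => ext f.1 (Φ t)) (ball 0 1) :=
    f.2.1.differentiableOn.comp hΦ hmaps
  have hball : Set.MapsTo (fun t => ext f.1 (Φ t)) (ball 0 1)
      (closedBall (ext f.1 (Φ 0)) (1 + ‖ext f.1 (Φ 0)‖)) := fun t _ => by
    rw [mem_closedBall, dist_eq_norm]
    exact (norm_sub_le _ _).trans (add_le_add_left ((norm_ext_le f _).trans hf) _)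
  simpa [dist_eq_norm] using Complex.dist_le_div_mul_dist_of_mapsTo_ball hdiff hball ht

theorem rho_le_of_tendsto_discs {l : Filter ι} [l.NeBot] {Φ : ι → ℂ → X} (hs₀ : 0 ≤ s)
    (hs : s < 1)
    (hΦ : ∀ᶠ i in l, DifferentiableOn ℂ (Φ i) (ball 0 1) ∧
      Set.MapsTo (Φ i) (ball 0 1) (ball 0 1))
    (hφ : ∀ f : Au X, Tendsto (fun i => ext f.1 (Φ i s)) l (𝓝 (φ f)))
    (hψ : ∀ f : Au X, Tendsto (fun i => ext f.1 (Φ i 0)) l (𝓝 (ψ f))) : rho φ ψ ≤ s := by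
  refine rho_le fun f hf hf₀ => ?_
  have hsnorm : ‖(s : ℂ)‖ = s := by rw [Complex.norm_real, Real.norm_of_nonneg hs₀]
  have hlim : ‖φ f - ψ f‖ ≤ (1 + ‖ψ f‖) * ‖(s : ℂ)‖ :=
    le_of_tendsto_of_tendsto ((hφ f).sub (hψ f)).norm (((hψ f).norm.const_add 1).mul_const _) <|
      hΦ.mono fun i hi => norm_sub_le_of_analytic_disc hi.1 hi.2 hf <| by
        rwa [mem_ball_zero_iff, hsnorm]
  rwa [hf₀, sub_zero, norm_zero, add_zero, one_mul, hsnorm] at hlim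

theorem rho_le_norm_mobius {a b : ℂ} (ha : ‖a‖ ≤ 1) (hb : ‖b‖ ≤ 1) {φ ψ : Spec ℂ}
    (hφ : ∀ f, φ f = evalClosed f a) (hψ : ∀ f, ψ f = evalClosed f b) :
    rho φ ψ ≤ ‖mobius a b‖ := by
  rcases (norm_mobius_le_one ha hb).lt_or_eq with hs | hs
  · obtain ⟨Φ, hdiff, hmaps, hΦs, hΦ₀⟩ := exists_analytic_disc ha hb hs le_rfl
    refine rho_le_of_tendsto_discs (l := 𝓝[<] (1 : ℝ)) (Φ := fun r t => (r : ℂ) • Φ t)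
      (norm_nonneg _) hs ?_ (fun f => ?_) fun f => ?_
    · filter_upwards [Ioo_mem_nhdsLT zero_lt_one] with r hr
      exact ⟨hdiff.fun_const_smul (r : ℂ), fun t ht => mem_ball_zero_iff.2
        (norm_ofReal_smul_lt_one hr (mem_closedBall_zero_iff.1 (hmaps ht)))⟩
    · simpa only [hΦs, ← hφ] using tendsto_evalClosed f ha
    · simpa only [hΦ₀, ← hψ] using tendsto_evalClosed f hb
  · exact (rho_le_one φ ψ).trans_eq hs.symm

set_option maxSynthPendingDepth 3 in
theorem rho_le_of_forall_norm_mobius_le {ζ ξ : Bidual C₀(ℕ, ℂ)} (hζ : ‖ζ‖ ≤ 1) (hξ : ‖ξ‖ ≤ 1)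
    {φ ψ : Spec C₀(ℕ, ℂ)} (hφ : ∀ f, φ f = canonicalExtClosed f ζ)
    (hψ : ∀ f, ψ f = canonicalExtClosed f ξ)
    (h : ∀ n, ‖mobius (ζ (coordFun n)) (ξ (coordFun n))‖ ≤ s) : rho φ ψ ≤ s := by
  rcases lt_or_ge s 1 with hs | hs
  · choose Φ hdiff hmaps hΦs hΦ₀ using fun n => exists_analytic_disc
      ((norm_bidual_coordFun_le ζ n).trans hζ) ((norm_bidual_coordFun_le ξ n).trans hξ) hs (h n)
    have := curry_neBot (l := 𝓝[<] (1 : ℝ)) (m := (atTop : Filter ℕ))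
    refine rho_le_of_tendsto_discs (l := (𝓝[<] (1 : ℝ)).curry atTop)
      (Φ := fun p t => (p.1 : ℂ) • ∑ n ∈ Finset.range p.2, Φ n t • unitVec n)
      ((norm_nonneg _).trans (h 0)) hs ?_ (fun f => ?_) fun f => ?_
    · refine eventually_curry_iff.2 ?_
      filter_upwards [Ioo_mem_nhdsLT zero_lt_one] with r hr
      refine Eventually.of_forall fun N => ⟨?_, fun t ht => mem_ball_zero_iff.2 ?_⟩
      · exact (DifferentiableOn.fun_sum fun n _ =>
          (hdiff n).smul_const (unitVec n)).const_smul (r : ℂ)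
      · exact norm_ofReal_smul_lt_one hr (norm_sum_smul_unitVec_le zero_le_one
          (fun n => mem_closedBall_zero_iff.1 (hmaps n ht)) _)
    · simpa only [hΦs, ← trunc_eq_sum, ← hφ] using tendsto_canonicalExtClosed f hζ
    · simpa only [hΦ₀, ← trunc_eq_sum, ← hψ] using tendsto_canonicalExtClosed f hξ
  · exact (rho_le_one φ ψ).trans hs

end AnalyticDiscs

section Density

variable {X : Type*} [NormedAddCommGroup X] [NormedSpace ℂ X]

/-- A continuous linear functional on `X`, as an element of `𝒜ᵤ(B_X)`. -/
def linAu (y : StrongDual ℂ X) : Au X :=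
  mkAu y (y.analyticOnNhd _) y.uniformContinuous.uniformContinuousOn ‖y‖ fun _ hx =>
    y.unit_le_opNorm _ (mem_ball_zero_iff.1 hx).le

theorem ext_linAu (y : StrongDual ℂ X) : Set.EqOn (ext (linAu y).1) y (ball 0 1) :=
  ext_mkAu _ _ _ _

theorem ballEval_linAu (x : ball (0 : X) 1) (y : StrongDual ℂ X) : ballEval x (linAu y) = y x := rfl

theorem norm_linAu_le (y : StrongDual ℂ X) : ‖linAu y‖ ≤ ‖y‖ :=
  norm_le_of_forall_ext_le y.opNorm_nonneg fun x hx => by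
    rw [ext_linAu y hx]
    exact y.unit_le_opNorm _ (mem_ball_zero_iff.1 hx).le

theorem norm_diag_le {m : ℕ} (A : X [×m]→L[ℂ] ℂ) {x : X} (hx : x ∈ ball (0 : X) 1) :
    ‖A fun _ => x‖ ≤ ‖A‖ :=
  A.unit_le_opNorm ((pi_norm_const_le x).trans (mem_ball_zero_iff.1 hx).le)

theorem uniformContinuousOn_diag {m : ℕ} (A : X [×m]→L[ℂ] ℂ) :
    UniformContinuousOn (fun x => A fun _ => x) (ball 0 1) := by
  refine LipschitzOnWith.uniformContinuousOn (K := ‖A‖₊ * m)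
    (LipschitzOnWith.of_dist_le_mul fun x hx y hy => ?_)
  have hdiag : ∀ z : X, ‖fun _ : Fin m => z‖ ≤ ‖z‖ := pi_norm_const_le
  have hmax : max ‖fun _ : Fin m => x‖ ‖fun _ : Fin m => y‖ ≤ 1 :=
    max_le ((hdiag x).trans (mem_ball_zero_iff.1 hx).le)
      ((hdiag y).trans (mem_ball_zero_iff.1 hy).le)
  rw [dist_eq_norm, dist_eq_norm]
  calc ‖(A fun _ => x) - A fun _ => y‖
      ≤ ‖A‖ * Fintype.card (Fin m) *
          max ‖fun _ : Fin m => x‖ ‖fun _ : Fin m => y‖ ^ (Fintype.card (Fin m) - 1) *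
          ‖(fun _ : Fin m => x) - fun _ : Fin m => y‖ := A.norm_image_sub_le _ _
    _ ≤ ‖A‖ * m * 1 * ‖x - y‖ := by
        rw [Fintype.card_fin]
        gcongr
        · exact pow_le_one₀ (le_max_of_le_left (norm_nonneg _)) hmax
        · exact hdiag (x - y)
    _ = (‖A‖₊ * m : NNReal) * ‖x - y‖ := by simp

theorem analyticOnNhd_diag {m : ℕ} (A : X [×m]→L[ℂ] ℂ) (s : Set X) :
    AnalyticOnNhd ℂ (fun x => A fun _ => x) s := fun _ _ =>
  A.analyticAt.comp (AnalyticAt.pi fun _ => analyticAt_id)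

/-- The homogeneous polynomial `x ↦ A (x, …, x)`, as an element of `𝒜ᵤ(B_X)`. -/
def polyAu (m : ℕ) : (X [×m]→L[ℂ] ℂ) →L[ℂ] Au X :=
  LinearMap.mkContinuous
    { toFun := fun A => mkAu (fun x => A fun _ => x) (analyticOnNhd_diag A _)
        (uniformContinuousOn_diag A) ‖A‖ fun _ hx => norm_diag_le A hx
      map_add' := fun _ _ => rfl
      map_smul' := fun _ _ => rfl } 1 fun A => by
    rw [one_mul]
    exact (BoundedContinuousFunction.norm_le (norm_nonneg A)).2 fun x => norm_diag_le A x.2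

theorem ballEval_polyAu (x : ball (0 : X) 1) {m : ℕ} (A : X [×m]→L[ℂ] ℂ) :
    ballEval x (polyAu m A) = A fun _ => x.1 := rfl

theorem exists_norm_ext_smul_sub_le (f : Au X) {ε : ℝ} (hε : 0 < ε) :
    ∃ r ∈ Set.Ioo (0 : ℝ) 1, ∀ x ∈ ball (0 : X) 1, ‖ext f.1 ((r : ℂ) • x) - ext f.1 x‖ ≤ ε := by
  obtain ⟨d, hd, hf⟩ := Metric.uniformContinuousOn_iff_le.1 (uniformContinuousOn_ext f) ε hε
  have hdist : Tendsto (fun r : ℝ => ‖(r : ℂ) - 1‖) (𝓝[<] 1) (𝓝 0) := by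
    simpa using ((tendsto_ofReal_smul (1 : ℂ)).sub_const 1).norm
  obtain ⟨r, hrd, hr⟩ :=
    ((hdist.eventually_le_const hd).and (Ioo_mem_nhdsLT zero_lt_one)).exists
  refine ⟨r, hr, fun x hx => ?_⟩
  have hx₁ : ‖x‖ ≤ 1 := (mem_ball_zero_iff.1 hx).le
  rw [← dist_eq_norm]
  refine hf _ (mem_ball_zero_iff.2 (norm_ofReal_smul_lt_one hr hx₁)) x hx ?_
  calc dist ((r : ℂ) • x) x = ‖(r : ℂ) - 1‖ * ‖x‖ := by
        rw [dist_eq_norm, ← norm_smul, sub_smul, one_smul]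
    _ ≤ d := (mul_le_of_le_one_right (norm_nonneg _) hx₁).trans hrd

theorem norm_sum_pow_mul_taylorForm_sub_le (f : Au X) {r : ℝ} (hr : r ∈ Set.Ioo (0 : ℝ) 1) {x : X}
    (hx : x ∈ ball (0 : X) 1) (M : ℕ) :
    ‖(∑ m ∈ Finset.range M, (r : ℂ) ^ m * taylorForm (ext f.1) m fun _ => x) -
      ext f.1 ((r : ℂ) • x)‖ ≤ ‖f‖ * r ^ M / (1 - r) := by
  have hx₁ : ‖x‖ ≤ 1 := (mem_ball_zero_iff.1 hx).le
  have hterm : ∀ m, ‖taylorForm (ext f.1) m fun _ => (r : ℂ) • x‖ ≤ ‖f‖ * r ^ m := fun m => by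
    refine (norm_taylorForm_le f.2.1 (fun x _ => norm_ext_le f x) m _).trans ?_
    gcongr
    rw [norm_smul, Complex.norm_real, Real.norm_of_nonneg hr.1.le]
    exact mul_le_of_le_one_right hr.1.le hx₁
  have hhom : ∀ m, (taylorForm (ext f.1) m fun _ => (r : ℂ) • x) =
      (r : ℂ) ^ m * taylorForm (ext f.1) m fun _ => x := fun m => by
    rw [(taylorForm (ext f.1) m).map_smul_univ (fun _ => (r : ℂ)) fun _ => x, Finset.prod_const,
      Finset.card_fin, smul_eq_mul]
  simpa only [hhom] using norm_sub_le_of_geometric_bound_of_hasSum hr.2 hterm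
    (hasSum_taylorForm f.2.1 (norm_ofReal_smul_lt_one hr hx₁)) M

theorem exists_norm_sum_polyAu_sub_le (f : Au X) {ε : ℝ} (hε : 0 < ε) :
    ∃ (M : ℕ) (r : ℂ),
      ‖∑ m ∈ Finset.range M, r ^ m • polyAu m (taylorForm (ext f.1) m) - f‖ ≤ ε := by
  obtain ⟨r, hr, hf⟩ := exists_norm_ext_smul_sub_le f (half_pos hε)
  have htail : Tendsto (fun M : ℕ => ‖f‖ * r ^ M / (1 - r)) atTop (𝓝 (‖f‖ * 0 / (1 - r))) :=
    ((tendsto_pow_atTop_nhds_zero_of_lt_one hr.1.le hr.2).const_mul ‖f‖).div_const (1 - r)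
  rw [mul_zero, zero_div] at htail
  obtain ⟨M, hM⟩ := (htail.eventually_le_const (half_pos hε)).exists
  refine ⟨M, r, norm_le_of_forall_ext_le hε.le fun x hx => ?_⟩
  have hval : ext (∑ m ∈ Finset.range M, (r : ℂ) ^ m • polyAu m (taylorForm (ext f.1) m) - f).1 x =
      (∑ m ∈ Finset.range M, (r : ℂ) ^ m * taylorForm (ext f.1) m fun _ => x) - ext f.1 x := by
    rw [← ballEval_apply hx, map_sub, map_sum, ballEval_apply hx]
    rfl
  rw [hval]
  calc ‖(∑ m ∈ Finset.range M, (r : ℂ) ^ m * taylorForm (ext f.1) m fun _ => x) - ext f.1 x‖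
      ≤ ‖(∑ m ∈ Finset.range M, (r : ℂ) ^ m * taylorForm (ext f.1) m fun _ => x) -
          ext f.1 ((r : ℂ) • x)‖ + ‖ext f.1 ((r : ℂ) • x) - ext f.1 x‖ :=
        norm_sub_le_norm_sub_add_norm_sub _ _ _
    _ ≤ ε / 2 + ε / 2 :=
        add_le_add ((norm_sum_pow_mul_taylorForm_sub_le f hr hx M).trans hM) (hf x hx)
    _ = ε := add_halves ε

theorem mem_topologicalClosure_of_polyAu_mem {S : Subalgebra ℂ (Au X)}
    (hS : ∀ m A, polyAu m A ∈ S.topologicalClosure) (f : Au X) : f ∈ S.topologicalClosure := by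
  refine S.isClosed_topologicalClosure.closure_subset (Metric.mem_closure_iff.2 fun ε hε => ?_)
  obtain ⟨M, r, hle⟩ := exists_norm_sum_polyAu_sub_le f (half_pos hε)
  refine ⟨∑ m ∈ Finset.range M, r ^ m • polyAu m (taylorForm (ext f.1) m),
    sum_mem fun m _ => S.topologicalClosure.smul_mem (hS m _) _, ?_⟩
  rw [dist_comm, dist_eq_norm]
  exact hle.trans_lt (half_lt_self hε)

end Density

section Coordinates

/-- The `n`-th coordinate, as an element of `𝒜ᵤ(B_{c₀})`. -/
def coordAu (n : ℕ) : Au C₀(ℕ, ℂ) := linAu (coordFun n)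

theorem norm_coordAu_le (n : ℕ) : ‖coordAu n‖ ≤ 1 :=
  (norm_linAu_le _).trans (norm_coordFun_le n)

theorem polyAu_comp_proj_mem_adjoin {m : ℕ} (A : C₀(ℕ, ℂ) [×m]→L[ℂ] ℂ) (N : ℕ) :
    polyAu m (A.compContinuousLinearMap fun _ => proj N) ∈
      Algebra.adjoin ℂ (Set.range coordAu) := by
  have hexpand : polyAu m (A.compContinuousLinearMap fun _ => proj N) =
      ∑ s ∈ Fintype.piFinset fun _ : Fin m => Finset.range N,
        A (fun i => unitVec (s i)) • ∏ i, coordAu (s i) := by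
    refine eq_of_forall_ballEval_eq fun x => ?_
    simp only [map_sum, map_smul, map_prod, coordAu, ballEval_linAu, ballEval_polyAu,
      coordFun_apply, ContinuousMultilinearMap.compContinuousLinearMap_apply, proj_eq_sum,
      A.map_sum_finset, A.map_smul_univ, smul_eq_mul, mul_comm]
  rw [hexpand]
  exact Subalgebra.sum_mem _ fun s _ => Subalgebra.smul_mem _ (Subalgebra.prod_mem _ fun i _ =>
    Algebra.subset_adjoin (Set.mem_range_self _)) _

theorem topologicalClosure_adjoin_coordAu :
    (Algebra.adjoin ℂ (Set.range coordAu)).topologicalClosure = ⊤ := by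
  refine eq_top_iff.2 fun f _ => mem_topologicalClosure_of_polyAu_mem (fun m A => ?_) f
  exact mem_closure_of_tendsto (((polyAu m).continuous.tendsto A).comp
    (hasNoC0_complex.tendsto_compContinuousLinearMap_proj m A))
    (Eventually.of_forall fun N => polyAu_comp_proj_mem_adjoin A N)

theorem spec_eq_of_forall_coordAu_eq {φ ψ : Spec C₀(ℕ, ℂ)}
    (h : ∀ n, φ (coordAu n) = ψ (coordAu n)) : φ = ψ := by
  have hle : (Algebra.adjoin ℂ (Set.range coordAu)).topologicalClosure ≤
      AlgHom.equalizer (WeakDual.CharacterSpace.toAlgHom φ)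
        (WeakDual.CharacterSpace.toAlgHom ψ) :=
    Subalgebra.topologicalClosure_minimal
      (Algebra.adjoin_le (Set.range_subset_iff.2 h))
      (isClosed_eq (map_continuous φ) (map_continuous ψ))
  rw [topologicalClosure_adjoin_coordAu] at hle
  exact DFunLike.ext _ _ fun f => hle (Algebra.mem_top (x := f))

end Coordinates

section Evaluations

theorem toBidual_coordFun (z : ℓ^∞(ℕ, ℂ)) (n : ℕ) : toBidual z (coordFun n) = z n := by
  change ∑' k, z k * unitVec k n = z n
  rw [tsum_eq_single n]
  · simp [unitVec_apply]
  · intro k hk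
    simp [unitVec_apply, hk.symm]

theorem norm_toBidual_le_one (z : closedBall (0 : ℓ^∞(ℕ, ℂ)) 1) : ‖toBidual z.1‖ ≤ 1 :=
  (LinearMap.mkContinuous_norm_le _ (norm_nonneg z.1) _).trans (mem_closedBall_zero_iff.1 z.2)

/-- The functional `δ_z`, the evaluation of the canonical extension at `z`. -/
def delta (z : closedBall (0 : ℓ^∞(ℕ, ℂ)) 1) : Spec C₀(ℕ, ℂ) :=
  (exists_spec_canonicalExtClosed (norm_toBidual_le_one z)).choose

theorem delta_apply (z : closedBall (0 : ℓ^∞(ℕ, ℂ)) 1) (f : Au C₀(ℕ, ℂ)) :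
    delta z f = canonicalExtClosed f (toBidual z.1) :=
  (exists_spec_canonicalExtClosed (norm_toBidual_le_one z)).choose_spec f

/-- The functional `δ_a` on the disc algebra, the evaluation at `a`. -/
def deltaD (a : closedBall (0 : ℂ) 1) : Spec ℂ :=
  (exists_spec_evalClosed (mem_closedBall_zero_iff.1 a.2)).choose

theorem deltaD_apply (a : closedBall (0 : ℂ) 1) (f : Au ℂ) : deltaD a f = evalClosed f a.1 :=
  (exists_spec_evalClosed (mem_closedBall_zero_iff.1 a.2)).choose_spec f

theorem delta_coordAu (z : closedBall (0 : ℓ^∞(ℕ, ℂ)) 1) (n : ℕ) :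
    delta z (coordAu n) = z.1 n :=
  (delta_apply z _).trans ((canonicalExtClosed_eq_of_eqOn_dual (norm_toBidual_le_one z)
    (ext_linAu _)).trans (toBidual_coordFun z.1 n))

theorem deltaD_linAu (a : closedBall (0 : ℂ) 1) (y : StrongDual ℂ ℂ) :
    deltaD a (linAu y) = y a.1 := by
  rw [deltaD_apply]
  exact evalClosed_eq_of_continuousAt (mem_closedBall_zero_iff.1 a.2) (ext_linAu y)
    y.continuous.continuousAt

theorem delta_surjective : Function.Surjective delta := fun φ => by
  have hφ : ∀ n, ‖φ (coordAu n)‖ ≤ 1 := fun n => norm_spec_apply_le_one φ (norm_coordAu_le n)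
  let w : ℓ^∞(ℕ, ℂ) := ⟨fun n => φ (coordAu n), memℓp_infty ⟨1, Set.forall_mem_range.2 hφ⟩⟩
  have hw : w ∈ closedBall (0 : ℓ^∞(ℕ, ℂ)) 1 :=
    mem_closedBall_zero_iff.2 (lp.norm_le_of_forall_le zero_le_one hφ)
  exact ⟨⟨w, hw⟩, spec_eq_of_forall_coordAu_eq fun n => delta_coordAu ⟨w, hw⟩ n⟩

theorem rho_deltaD (a b : closedBall (0 : ℂ) 1) : rho (deltaD a) (deltaD b) = ‖mobius a.1 b.1‖ := by
  refine le_antisymm (rho_le_norm_mobius (mem_closedBall_zero_iff.1 a.2)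
    (mem_closedBall_zero_iff.1 b.2) (deltaD_apply a) (deltaD_apply b)) ?_
  have hid : ‖linAu (ContinuousLinearMap.id ℂ ℂ)‖ ≤ 1 :=
    (norm_linAu_le _).trans ContinuousLinearMap.norm_id_le
  simpa only [deltaD_linAu, ContinuousLinearMap.id_apply] using
    norm_mobius_le_rho (deltaD a) (deltaD b) hid

variable (z w : closedBall (0 : ℓ^∞(ℕ, ℂ)) 1)

theorem norm_coord_le_one (n : ℕ) : ‖z.1 n‖ ≤ 1 := mem_closedBall_zero_iff.1 (coord z n).2

theorem bddAbove_range_norm_mobius_coord :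
    BddAbove (Set.range fun n => ‖mobius (z.1 n) (w.1 n)‖) :=
  ⟨1, Set.forall_mem_range.2 fun n =>
    norm_mobius_le_one (norm_coord_le_one z n) (norm_coord_le_one w n)⟩

theorem rho_delta : rho (delta z) (delta w) = ⨆ n, ‖mobius (z.1 n) (w.1 n)‖ := by
  refine le_antisymm (rho_le_of_forall_norm_mobius_le (norm_toBidual_le_one z)
    (norm_toBidual_le_one w) (delta_apply z) (delta_apply w) fun n => ?_) (ciSup_le fun n => ?_)
  · simpa only [toBidual_coordFun] using le_ciSup (bddAbove_range_norm_mobius_coord z w) n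
  · simpa only [delta_coordAu] using norm_mobius_le_rho (delta z) (delta w) (norm_coordAu_le n)

theorem rho_delta_eq_iSup_rho_deltaD :
    rho (delta z) (delta w) = ⨆ n, rho (deltaD (coord z n)) (deltaD (coord w n)) := by
  simp only [rho_delta, rho_deltaD, coord]

theorem rho_delta_eq_iSup_ne :
    rho (delta z) (delta w) = ⨆ n : {n : ℕ // z.1 n ≠ w.1 n}, ‖mobius (z.1 n) (w.1 n)‖ := by
  have hbdd := bddAbove_range_norm_mobius_coord z w
  have hnonneg : 0 ≤ ⨆ n : {n : ℕ // z.1 n ≠ w.1 n}, ‖mobius (z.1 n) (w.1 n)‖ :=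
    Real.iSup_nonneg fun _ => norm_nonneg _
  rw [rho_delta]
  refine le_antisymm (ciSup_le fun n => ?_) (Real.iSup_le (fun n => le_ciSup hbdd n.1)
    (Real.iSup_nonneg fun _ => norm_nonneg _))
  rcases eq_or_ne (z.1 n) (w.1 n) with heq | hne
  · rwa [heq, mobius_self, norm_zero]
  · exact le_ciSup (f := fun n : {n : ℕ // z.1 n ≠ w.1 n} => ‖mobius (z.1 n) (w.1 n)‖)
      (hbdd.mono (Set.range_comp_subset_range Subtype.val fun n => ‖mobius (z.1 n) (w.1 n)‖))
      ⟨n, hne⟩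

theorem rho_delta_lt_one_iff : rho (delta z) (delta w) < 1 ↔
    ∃ r ∈ Set.Ioo (0 : ℝ) 1, ∀ n, (‖z.1 n‖ = 1 → w.1 n = z.1 n) ∧
      (‖z.1 n‖ < 1 → w.1 n ∈ pseudoDisc r (z.1 n)) := by
  rw [rho_delta]
  refine ⟨fun h => ?_, fun ⟨r, hr, h⟩ => (ciSup_le fun n => ?_).trans_lt hr.2⟩
  · obtain ⟨r, hr, hr₁⟩ := exists_between h
    have hlt : ∀ n, ‖mobius (z.1 n) (w.1 n)‖ < r := fun n =>
      (le_ciSup (bddAbove_range_norm_mobius_coord z w) n).trans_lt hr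
    refine ⟨r, ⟨(norm_nonneg _).trans_lt (hlt 0), hr₁⟩, fun n => ⟨fun hz => ?_, fun hz => ?_⟩⟩
    · by_contra hne
      exact ((hlt n).trans hr₁).ne (norm_mobius_eq_one hz (Ne.symm hne))
    · refine ⟨(norm_coord_le_one w n).lt_of_ne fun hw => ?_, hlt n⟩
      have hne : w.1 n ≠ z.1 n := fun heq => hz.ne (heq ▸ hw)
      exact ((hlt n).trans hr₁).ne (norm_mobius_comm _ _ ▸ norm_mobius_eq_one hw hne)
  · rcases (norm_coord_le_one z n).lt_or_eq with hz | hz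
    · exact ((h n).2 hz).2.le
    · rw [(h n).1 hz, mobius_self, norm_zero]
      exact hr.1.le

theorem gleasonPart_delta : gleasonPart (delta z) =
    ⋃ r ∈ Set.Ioo (0 : ℝ) 1, {φ | ∃ w, φ = delta w ∧ ∀ n : ℕ,
      (‖z.1 n‖ = 1 → w.1 n = z.1 n) ∧ (‖z.1 n‖ < 1 → w.1 n ∈ pseudoDisc r (z.1 n))} := by
  ext φ
  simp only [Set.mem_iUnion, Set.mem_ofPred_eq, gleasonPart, exists_prop]
  constructor
  · obtain ⟨w, rfl⟩ := delta_surjective φ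
    intro h
    obtain ⟨r, hr, hw⟩ := (rho_delta_lt_one_iff z w).1 h
    exact ⟨r, hr, w, rfl, hw⟩
  · rintro ⟨r, hr, w, rfl, hw⟩
    exact (rho_delta_lt_one_iff z w).2 ⟨r, hr, hw⟩

end Evaluations

end GleasonC0

end

theorem mainTheorem1 :
    ∃ (δ : Metric.closedBall (0 : lp (fun _ : ℕ => ℂ) ⊤) 1 → GleasonC0.Spec C₀(ℕ, ℂ))
      (δD : Metric.closedBall (0 : ℂ) 1 → GleasonC0.Spec ℂ),
      -- `δ z` is evaluation at `z` of the canonical extension to the closed ball of `ℓ_∞ = c₀**`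
      (∀ z f, δ z f = GleasonC0.canonicalExtClosed f (GleasonC0.toBidual z.1)) ∧
      -- `δD a` is evaluation at the point `a` of the closed disc
      (∀ a f, δD a f = GleasonC0.evalClosed f a.1) ∧
      (∀ z w, GleasonC0.gleasonDist (δ z) (δ w) =
        ⨆ n : ℕ, GleasonC0.gleasonDist (δD (GleasonC0.coord z n)) (δD (GleasonC0.coord w n))) ∧
      (∀ z w, GleasonC0.rho (δ z) (δ w) =
        ⨆ n : ℕ, GleasonC0.rho (δD (GleasonC0.coord z n)) (δD (GleasonC0.coord w n))) ∧
      (∀ z w, GleasonC0.rho (δ z) (δ w) =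
        ⨆ n : {n : ℕ // z.1 n ≠ w.1 n},
          ‖(z.1 n - w.1 n) / (1 - starRingEnd ℂ (z.1 n) * w.1 n)‖) ∧
      (∀ z, GleasonC0.gleasonPart (δ z) =
        ⋃ r ∈ Set.Ioo (0 : ℝ) 1, {φ | ∃ w, φ = δ w ∧ ∀ n : ℕ,
          (‖z.1 n‖ = 1 → w.1 n = z.1 n) ∧
          (‖z.1 n‖ < 1 → w.1 n ∈ GleasonC0.pseudoDisc r (z.1 n))}) :=
  ⟨GleasonC0.delta, GleasonC0.deltaD, GleasonC0.delta_apply, GleasonC0.deltaD_apply,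
    fun z w => GleasonC0.gleasonDist_eq_iSup_of_rho_eq_iSup
      (GleasonC0.rho_delta_eq_iSup_rho_deltaD z w),
    GleasonC0.rho_delta_eq_iSup_rho_deltaD,
    GleasonC0.rho_delta_eq_iSup_ne,
    GleasonC0.gleasonPart_delta⟩
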